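/- Let $k\ge 2$ and $d\ge 2$ be fixed integers, let $\mathbf p=(p_1,\dots,p_k)$ be a probability vector with all $p_i>0$, and let $Q_{\mathbf T}\ge 0$ be fixed numbers indexed by the vectors $\mathbf T\in\mathbb N^k$ with $T_1+\dots+T_k=d$. In the $d$-uniform hypergraph stochastic block model on $n$ nodes, the labels $Z_1,\dots,Z_n\in[k]$ are i.i.d. with law $\mathbf p$, and, given $\mathbf Z$, each $d$-subset $e$ of $[n]$ is a hyperedge of $G$ independently with probability $Q_{\mathbf T(e)}\frac{\log n}{n^{d-1}}$ (truncated at $1$, which matters for at most finitely many $n$), where $\mathbf T(e)$ counts the nodes of $e$ in each community. An estimator is a sequence (in $n$) of maps, possibly randomized, from hypergraphs $G$ to label vectors $\widehat{\mathbf Z}\in[k]^n$. It achieves exact recovery if, as $n\to\infty$, $$\mathbb P\big(l(\widehat{\mathbf Z},\mathbf Z)=0\big)\to 1,\qquad l(\widehat{\mathbf Z},\mathbf Z)=\min_{\pi\in\mathcal S_k}\frac1n\sum_{v=1}^n \mathbf 1\{\widehat Z_v\ne\pi(Z_v)\},$$ where $\mathcal S_k$ is the set of permutations of $[k]$. For $\mathbf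 m\in\mathcal M=\{\mathbf m\in\mathbb N^k: m_1+\dots+m_k=d-1\}$ put $$R'_{\mathbf m}=\lim_{n\to\infty}\frac{1}{n^{d-1}}\prod_{s=1}^k\binom{np_s}{m_s}=\prod_{s=1}^k\frac{p_s^{m_s}}{m_s!},\qquad \mu_{\mathbf m\oplus i}=R'_{\mathbf m}\,Q_{\mathbf m\oplus i},$$ where $\mathbf m\oplus i$ is $\mathbf m$ with its $i$-th entry increased by one, and for $i\ne j$ define the generalized Chernoff–Hellinger divergence $$D_+(i,j)=\sup_{t\in[0,1]}\sum_{\mathbf m\in\mathcal M}\Big(t\,\mu_{\mathbf m\oplus i}+(1-t)\,\mu_{\mathbf m\oplus j}-\mu_{\mathbf m\oplus i}^{\,t}\,\mu_{\mathbf m\oplus j}^{\,1-t}\Big),$$ which is a maximum when all $Q_{\mathbf T}>0$. **Theorem (Converse).** If $\min_{i,j\in[k],\,i\ne j}D_+(i,j)<1$, then no estimator achieves exact recovery. -/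

import Mathlib

open scoped BigOperators

noncomputable section

namespace HSBM

/-- The order-`d` hyperedges on the node set `Fin n`. -/
abbrev Hyperedge (n d : ℕ) : Type := {e : Finset (Fin n) // e.card = d}

/-- A `d`-uniform hypergraph on `Fin n`, given by its set of hyperedges. -/
abbrev Hypergraph (n d : ℕ) : Type := Finset (Hyperedge n d)

/-- A community vector: each of the `n` nodes carries one of `k` labels. -/
abbrev Labeling (n k : ℕ) : Type := Fin n → Fin k

/-- The community assignment of a hyperedge: the number of its nodes in each community. -/
def assignment {n k d : ℕ} (z : Labeling n k) (e : Hyperedge n d) : Fin k → ℕ :=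
  fun i => (e.1.filter (fun v => z v = i)).card

/-- The probability that the hyperedge `e` is present, given the community vector `z`.
It is `Q_T log n / n ^ (d - 1)`; the truncation at `1` acts for at most finitely many `n`, for which
the formula would not be a probability. -/
def edgeProb {n k d : ℕ} (Q : (Fin k → ℕ) → ℝ) (z : Labeling n k) (e : Hyperedge n d) : ℝ :=
  min 1 (Q (assignment z e) * Real.log n / (n : ℝ) ^ (d - 1))

/-- The probability of the community vector `z`: labels are independent with law `p`. -/
def labelProb {n k : ℕ} (p : Fin k → ℝ) (z : Labeling n k) : ℝ :=
  ∏ v, p (z v)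

/-- The conditional probability of the hypergraph `G` given `z`: hyperedges are independent. -/
def graphProb {n k d : ℕ} (Q : (Fin k → ℕ) → ℝ) (z : Labeling n k) (G : Hypergraph n d) : ℝ :=
  ∏ e : Hyperedge n d, if e ∈ G then edgeProb Q z e else 1 - edgeProb Q z e

/-- The joint law of the community vector and the hypergraph, as a probability mass function. -/
def jointProb {n k d : ℕ} (p : Fin k → ℝ) (Q : (Fin k → ℕ) → ℝ)
    (z : Labeling n k) (G : Hypergraph n d) : ℝ :=
  labelProb p z * graphProb Q z G

/-- The joint masses are nonnegative. -/
theorem jointProb_nonneg {n k d : ℕ} {p : Fin k → ℝ} {Q : (Fin k → ℕ) → ℝ}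
    (hp : ∀ i, 0 ≤ p i) (hQ : ∀ T : Fin k → ℕ, ∑ i, T i = d → 0 ≤ Q T)
    (z : Labeling n k) (G : Hypergraph n d) : 0 ≤ jointProb p Q z G := by
  unfold jointProb labelProb graphProb
  refine mul_nonneg (Finset.prod_nonneg fun v _ => hp _) (Finset.prod_nonneg fun e _ => ?_)
  have hT : ∑ i, assignment z e i = d := by
    unfold assignment
    rw [← Finset.card_eq_sum_card_fiberwise (fun v _ => Finset.mem_coe.2 (Finset.mem_univ (z v)))]
    exact e.2
  have hq : 0 ≤ edgeProb Q z e :=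
    le_min zero_le_one (div_nonneg (mul_nonneg (hQ _ hT) (Real.log_natCast_nonneg n)) (by positivity))
  have hq' : edgeProb Q z e ≤ 1 := min_le_left _ _
  split_ifs <;> linarith

/-- The joint masses add up to one. -/
theorem sum_jointProb {n k d : ℕ} {p : Fin k → ℝ} (Q : (Fin k → ℕ) → ℝ)
    (hp : ∑ i, p i = 1) :
    ∑ z : Labeling n k, ∑ G : Hypergraph n d, jointProb p Q z G = 1 := by
  have h1 : ∀ z : Labeling n k, ∑ G : Hypergraph n d, graphProb Q z G = 1 := by
    intro z
    have h := Finset.prod_add (fun e : Hyperedge n d => edgeProb Q z e)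
      (fun e => 1 - edgeProb Q z e) Finset.univ
    simp only [add_sub_cancel, Finset.prod_const_one, Finset.powerset_univ] at h
    rw [h]
    refine Finset.sum_congr rfl fun G _ => ?_
    unfold graphProb
    rw [Finset.prod_ite]
    congr 2 <;> ext e <;> simp
  simp only [jointProb, ← Finset.mul_sum, h1, mul_one]
  unfold labelProb
  have h2 := Finset.sum_prod_piFinset (Finset.univ : Finset (Fin k)) (fun _ : Fin n => p)
  simp only [Fintype.piFinset_univ, hp, Finset.prod_const_one] at h2
  exact h2

/-- The misclassification proportion `l(ẑ, z)`: the least proportion of wrongly labelled nodes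
over all relabellings of the communities. -/
def misclassification {n k : ℕ} (zhat z : Labeling n k) : ℝ :=
  Finset.univ.inf' Finset.univ_nonempty fun π : Equiv.Perm (Fin k) =>
    (1 / (n : ℝ)) * ∑ v, if zhat v ≠ π (z v) then 1 else 0

/-- A (possibly randomized) estimator for each number of nodes: given the observed hypergraph it
outputs a community vector drawn from a law depending on the hypergraph only. A deterministic
estimator is one whose laws are point masses. -/
abbrev Estimator (k d : ℕ) : Type := (n : ℕ) → Hypergraph n d → PMF (Labeling n k)

open Classical in
/-- The probability of the event `l(Ẑ, Z) = 0`, over the community vector, the hypergraph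
and the internal randomness of the estimator. -/
def successProb {k d : ℕ} (p : Fin k → ℝ) (Q : (Fin k → ℕ) → ℝ) (φ : Estimator k d) (n : ℕ) : ℝ :=
  ∑ z : Labeling n k, ∑ G : Hypergraph n d, jointProb p Q z G *
    ∑ zhat : Labeling n k, if misclassification zhat z = 0 then (φ n G zhat).toReal else 0

/-- Exact recovery: `l(Ẑ, Z) = 0` with probability `1 - o(1)` as `n → ∞`. -/
def AchievesExactRecovery {k d : ℕ} (p : Fin k → ℝ) (Q : (Fin k → ℕ) → ℝ)
    (φ : Estimator k d) : Prop :=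
  Filter.Tendsto (successProb p Q φ) Filter.atTop (nhds 1)

/-- The expected number `R_m = ∏ₛ binom(n pₛ, mₛ)` of node combinations with community assignment
`m`, where `binom(x, r) = x (x - 1) ⋯ (x - r + 1) / r!` for real `x`. -/
def assignmentCount {k : ℕ} (p : Fin k → ℝ) (m : Fin k → ℕ) (n : ℕ) : ℝ :=
  ∏ s, (descPochhammer ℝ (m s)).eval (n * p s) / (m s).factorial

/-- The normalized count `R'_m`, the limit of `R_m / n ^ (d - 1)` as `n → ∞`; see
`tendsto_assignmentCount`. -/
def normalizedCount {k : ℕ} (p : Fin k → ℝ) (m : Fin k → ℕ) : ℝ :=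
  ∏ s, p s ^ m s / (m s).factorial

theorem tendsto_assignmentCount {k : ℕ} (p : Fin k → ℝ) (m : Fin k → ℕ) (r : ℕ)
    (hm : ∑ s, m s = r) :
    Filter.Tendsto (fun n : ℕ => assignmentCount p m n / (n : ℝ) ^ r) Filter.atTop
      (nhds (normalizedCount p m)) := by
  have key : ∀ (x : ℝ) (j : ℕ), Filter.Tendsto
      (fun n : ℕ => (descPochhammer ℝ j).eval (n * x) / (n : ℝ) ^ j) Filter.atTop
      (nhds (x ^ j)) := by
    intro x j
    induction j with
    | zero => simp
    | succ j ih =>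
      have h1 : Filter.Tendsto (fun n : ℕ => x - (j : ℝ) / (n : ℝ)) Filter.atTop (nhds x) := by
        simpa using (tendsto_const_nhds (x := x)).sub (tendsto_const_div_atTop_nhds_zero_nat (j : ℝ))
      rw [pow_succ]
      refine (ih.mul h1).congr' ?_
      filter_upwards [Filter.eventually_gt_atTop 0] with n hn
      have hn' : (n : ℝ) ≠ 0 := by positivity
      rw [descPochhammer_succ_eval]
      field_simp
      ring
  have h2 := tendsto_finsetProd Finset.univ
    (fun s _ => (key (p s) (m s)).div_const ((m s).factorial : ℝ))
  refine h2.congr fun n => ?_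
  unfold assignmentCount
  rw [← hm, ← Finset.prod_pow_eq_pow_sum, ← Finset.prod_div_distrib]
  exact Finset.prod_congr rfl fun s _ => by ring

/-- The set `𝓜` of community assignments of `d - 1` nodes. -/
def neighborAssignments (k d : ℕ) : Finset (Fin k → ℕ) :=
  Finset.piAntidiag Finset.univ (d - 1)

/-- `m ⊕ i`: one node of community `i` added to the community assignment `m`. -/
def addNode {k : ℕ} (m : Fin k → ℕ) (i : Fin k) : Fin k → ℕ :=
  m + Pi.single i 1

/-- The degree profile `μ_{m ⊕ i} = R'_m Q_{m ⊕ i}` of community `i`. -/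
def degreeProfile {k : ℕ} (p : Fin k → ℝ) (Q : (Fin k → ℕ) → ℝ) (i : Fin k) (m : Fin k → ℕ) : ℝ :=
  normalizedCount p m * Q (addNode m i)

/-- The generalized Chernoff-Hellinger divergence `D₊(i, j)`. The supremum over `t ∈ [0, 1]` is a
maximum when the values of `Q` are positive; when some vanish, it does not depend on the
convention for `0 ^ 0` at the end points. -/
def gchDivergence {k : ℕ} (d : ℕ) (p : Fin k → ℝ) (Q : (Fin k → ℕ) → ℝ) (i j : Fin k) : ℝ :=
  ⨆ t : Set.Icc (0 : ℝ) 1, ∑ m ∈ neighborAssignments k d,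
    ((t : ℝ) * degreeProfile p Q i m + (1 - (t : ℝ)) * degreeProfile p Q j m
      - degreeProfile p Q i m ^ (t : ℝ) * degreeProfile p Q j m ^ (1 - (t : ℝ)))

end HSBM

end

open Filter Topology

namespace HSBM

/-! If the hyperedges at a node are about as compatible with community `i` as with community `j`,
then no estimator labels that node correctly in both cases. Fix `i ≠ j` with divergence below 1. The
maximiser `t` of the Chernoff-Hellinger objective gives an intermediate intensity `τ`, the geometric
interpolation of the two degree profiles, whose Poisson divergences from both are at most the
divergence (`exists_balanced_profile`). So for some `ρ < 1`, a node of either community has `⌊τ m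
log n⌋` hyperedges of each neighbour type `m` with probability at least `n ^ (-ρ)`
(`eventually_exp_le_profileProb`).

Such a node is sought in a set `S` of about `n / log² n` nodes. It has more than `n ^ ρ` nodes, yet
is so sparse that a given node of `S` shares no present hyperedge with the rest of `S` with
probability at least 1/2. The hyperedges meeting `S` in a single node form disjoint families for
different nodes, hence independent ones given the labels.

The weight `nodeWeight` at `v` replaces the law of the exclusive hyperedges of `v` by the uniform
law on the configurations with the chosen profile, and keeps only graphs without shared hyperedges
at `v`. This removes almost all information about the label of `v`: exchanging `i` and `j` there
changes the weighted mass by a bounded factor (`graphProb_mul_nodeWeight`, `labelProb_le_relabel`),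
while the two labelings cannot both be recovered. Hence the weighted failure probability at each `v`
is bounded below. The weights are at most `|S|` and their cross moments at most 1, so their sum has
second moment of order `|S|²`. Cauchy-Schwarz (`sq_le_sum_of_paired`) then bounds the unweighted
failure probability below by a constant independent of `n` (`sq_le_failure`). -/

/-- The probability that the random subset of `A` containing each `e` independently with
probability `q e` is `H ∩ A`. -/
def bernWeight {α : Type*} [DecidableEq α] (q : α → ℝ) (A H : Finset α) : ℝ :=
  ∏ e ∈ A, if e ∈ H then q e else 1 - q e

/-- The density, with respect to `bernWeight q A`, of the uniform law on `C`. -/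
noncomputable def uniformDensity {α : Type*} [DecidableEq α] (q : α → ℝ) (A : Finset α)
    (C : Finset (Finset α)) (H : Finset α) : ℝ :=
  if H ∈ C then ((C.card : ℝ) * bernWeight q A H)⁻¹ else 0

/-! ### Product Bernoulli laws on finite sets. -/

section Bernoulli

variable {α : Type*} [DecidableEq α] {q : α → ℝ} {A B : Finset α}

theorem bernWeight_nonneg (h0 : ∀ e, 0 ≤ q e) (h1 : ∀ e, q e ≤ 1) (A H : Finset α) :
    0 ≤ bernWeight q A H :=
  Finset.prod_nonneg fun e _ => by split_ifs <;> linarith [h0 e, h1 e]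

theorem bernWeight_le_one (h0 : ∀ e, 0 ≤ q e) (h1 : ∀ e, q e ≤ 1) (A H : Finset α) :
    bernWeight q A H ≤ 1 :=
  Finset.prod_le_one (fun e _ => by split_ifs <;> linarith [h0 e, h1 e])
    fun e _ => by split_ifs <;> linarith [h0 e, h1 e]

theorem bernWeight_inter (q : α → ℝ) (A H : Finset α) :
    bernWeight q A (H ∩ A) = bernWeight q A H :=
  Finset.prod_congr rfl fun e he => by simp [he]

theorem bernWeight_union (q : α → ℝ) (h : Disjoint A B) (H : Finset α) :
    bernWeight q (A ∪ B) H = bernWeight q A H * bernWeight q B H :=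
  Finset.prod_union h

theorem sum_bernWeight (q : α → ℝ) (A : Finset α) :
    ∑ H ∈ A.powerset, bernWeight q A H = 1 := by
  have h := Finset.prod_add q (fun e => 1 - q e) A
  simp only [add_sub_cancel, Finset.prod_const_one] at h
  rw [h]
  refine Finset.sum_congr rfl fun H hH => ?_
  unfold bernWeight
  rw [Finset.prod_ite, Finset.filter_mem_eq_inter, Finset.filter_notMem_eq_sdiff,
    Finset.inter_eq_right.2 (Finset.mem_powerset.1 hH)]

/-- Independence: the restrictions of the random set to disjoint `A` and `B` have a product law. -/
theorem sum_bernWeight_union (q : α → ℝ) (h : Disjoint A B) (g g' : Finset α → ℝ) :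
    ∑ G ∈ (A ∪ B).powerset, bernWeight q (A ∪ B) G * (g (G ∩ A) * g' (G ∩ B)) =
      (∑ H ∈ A.powerset, bernWeight q A H * g H) * ∑ H ∈ B.powerset, bernWeight q B H * g' H := by
  rw [Finset.sum_mul_sum, ← Finset.sum_product']
  have hA : ∀ H K : Finset α, H ⊆ A → K ⊆ B → (H ∪ K) ∩ A = H := by
    intro H K hH hK
    ext e
    have := @Finset.disjoint_left _ A B
    simp only [Finset.mem_inter, Finset.mem_union]
    exact ⟨fun ⟨h1, h2⟩ => h1.resolve_right fun h3 => this.1 h h2 (hK h3),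
      fun h1 => ⟨Or.inl h1, hH h1⟩⟩
  have hB : ∀ H K : Finset α, H ⊆ A → K ⊆ B → (H ∪ K) ∩ B = K := by
    intro H K hH hK
    ext e
    have := @Finset.disjoint_left _ A B
    simp only [Finset.mem_inter, Finset.mem_union]
    exact ⟨fun ⟨h1, h2⟩ => h1.resolve_left fun h3 => this.1 h (hH h3) h2,
      fun h1 => ⟨Or.inr h1, hK h1⟩⟩
  refine Finset.sum_nbij' (fun G => (G ∩ A, G ∩ B)) (fun x => x.1 ∪ x.2) ?_ ?_ ?_ ?_ ?_
  · intro G _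
    simp
  · rintro ⟨H, K⟩ hx
    simp only [Finset.mem_product, Finset.mem_powerset] at hx ⊢
    exact Finset.union_subset_union hx.1 hx.2
  · intro G hG
    simp only [Finset.mem_powerset] at hG
    simp only [← Finset.inter_union_distrib_left]
    exact Finset.inter_eq_left.2 hG
  · rintro ⟨H, K⟩ hx
    simp only [Finset.mem_product, Finset.mem_powerset] at hx
    simp only [hA H K hx.1 hx.2, hB H K hx.1 hx.2]
  · intro G _
    rw [bernWeight_union q h, bernWeight_inter, bernWeight_inter]
    ring

theorem sum_bernWeight_mul [Fintype α] (q : α → ℝ) (h : Disjoint A B) (g g' : Finset α → ℝ) :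
    ∑ G : Finset α, bernWeight q Finset.univ G * (g (G ∩ A) * g' (G ∩ B)) =
      (∑ H ∈ A.powerset, bernWeight q A H * g H) * ∑ H ∈ B.powerset, bernWeight q B H * g' H := by
  have h1 := sum_bernWeight_union q (disjoint_compl_right (a := A ∪ B))
    (fun H => g (H ∩ A) * g' (H ∩ B)) (fun _ => 1)
  simp only [mul_one, sum_bernWeight, Finset.union_compl, Finset.powerset_univ] at h1
  rw [← sum_bernWeight_union q h, ← h1]
  refine Finset.sum_congr rfl fun G _ => ?_
  have e1 : (A ∪ B) ∩ A = A := Finset.inter_eq_right.2 Finset.subset_union_left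
  have e2 : (A ∪ B) ∩ B = B := Finset.inter_eq_right.2 Finset.subset_union_right
  simp only [Finset.inter_assoc, e1, e2]

/-- The union bound for the event that no element of `A` is chosen. -/
theorem one_sub_sum_le_bernWeight (h0 : ∀ e, 0 ≤ q e) (h1 : ∀ e, q e ≤ 1) (A : Finset α) :
    1 - ∑ e ∈ A, q e ≤ bernWeight q A ∅ := by
  induction A using Finset.induction_on with
  | empty => simp [bernWeight]
  | insert a A ha ih =>
    have h2 := bernWeight_le_one h0 h1 A ∅
    have h3 : bernWeight q (insert a A) ∅ = (1 - q a) * bernWeight q A ∅ := by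
      simp [bernWeight, Finset.prod_insert ha]
    rw [h3, Finset.sum_insert ha]
    nlinarith [h0 a, h1 a]

theorem uniformDensity_nonneg (h0 : ∀ e, 0 ≤ q e) (h1 : ∀ e, q e ≤ 1) (A : Finset α)
    (C : Finset (Finset α)) (H : Finset α) : 0 ≤ uniformDensity q A C H := by
  unfold uniformDensity
  split_ifs
  · exact inv_nonneg.2 (mul_nonneg (Nat.cast_nonneg _) (bernWeight_nonneg h0 h1 A H))
  · exact le_rfl

theorem sum_bernWeight_mul_uniformDensity {C : Finset (Finset α)} (hC : C ⊆ A.powerset)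
    (hne : C.Nonempty) (hpos : ∀ H ∈ C, bernWeight q A H ≠ 0) :
    ∑ H ∈ A.powerset, bernWeight q A H * uniformDensity q A C H = 1 := by
  have h1 : ∑ H ∈ A.powerset, bernWeight q A H * uniformDensity q A C H =
      ∑ H ∈ C, (C.card : ℝ)⁻¹ := by
    rw [← Finset.sum_subset hC]
    · refine Finset.sum_congr rfl fun H hH => ?_
      have := hpos H hH
      rw [uniformDensity, if_pos hH, mul_inv]
      field_simp
    · intro H _ hH
      simp [uniformDensity, hH]
  rw [h1, Finset.sum_const, nsmul_eq_mul, mul_inv_cancel₀]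
  exact_mod_cast hne.card_pos.ne'

end Bernoulli

/-! ### The second-moment inequality. -/

/-- A second-moment bound: the weights `w v` pair the points of `Ω` through the involutions `σ v`,
and on each pair the values of `f` add up to at least one. -/
theorem sq_le_sum_of_paired {Ω V : Type*} [Fintype Ω] [DecidableEq V] {S : Finset V}
    {P f : Ω → ℝ} {w : V → Ω → ℝ} {σ : V → Ω → Ω} {c C : ℝ} (hS : S.Nonempty)
    (hσ : ∀ v, Function.Involutive (σ v)) (hP : ∀ x, 0 ≤ P x) (hf0 : ∀ x, 0 ≤ f x)
    (hf1 : ∀ x, f x ≤ 1) (hw : ∀ v x, 0 ≤ w v x) (hc : 0 ≤ c) (hC : 0 ≤ C)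
    (hpair : ∀ v ∈ S, ∀ x, w v x ≠ 0 → 1 ≤ f x + f (σ v x))
    (hflip : ∀ v ∈ S, ∀ x, P x * w v x ≤ C * (P (σ v x) * w v (σ v x)))
    (hlow : ∀ v ∈ S, c ≤ ∑ x, P x * w v x) (hup : ∀ v ∈ S, ∑ x, P x * w v x ≤ 1)
    (hbound : ∀ v ∈ S, ∀ x, w v x ≤ S.card)
    (hcross : ∀ v ∈ S, ∀ u ∈ S, v ≠ u → ∑ x, P x * (w v x * w u x) ≤ 1) :
    c ^ 2 ≤ 2 * (1 + C) ^ 2 * ∑ x, P x * f x := by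
  have hs : (0 : ℝ) < S.card := by exact_mod_cast hS.card_pos
  set U : Ω → ℝ := fun x => ∑ v ∈ S, w v x with hU
  have h1 : ∀ v ∈ S, c ≤ (1 + C) * ∑ x, P x * f x * w v x := by
    intro v hv
    -- Flip each pair by `σ v`: the mass at the partner is comparable, so failure at the partner is
    -- charged to failure at the point itself.
    have e1 : ∑ x, P x * w v x * f (σ v x) ≤ ∑ x, C * (P x * f x * w v x) := by
      rw [← Equiv.sum_comp (hσ v).toPerm (fun x => C * (P x * f x * w v x))]
      refine Finset.sum_le_sum fun x _ => ?_
      have := mul_le_mul_of_nonneg_right (hflip v hv x) (hf0 (σ v x))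
      simp only [Function.Involutive.coe_toPerm]
      linarith
    have e2 : ∑ x, P x * w v x ≤ ∑ x, (P x * f x * w v x + P x * w v x * f (σ v x)) := by
      refine Finset.sum_le_sum fun x _ => ?_
      rcases eq_or_ne (w v x) 0 with h | h
      · simp [h]
      · have := mul_le_mul_of_nonneg_left (hpair v hv x h) (mul_nonneg (hP x) (hw v x))
        linarith
    rw [Finset.sum_add_distrib] at e2
    rw [← Finset.mul_sum] at e1
    linarith [hlow v hv]
  have h2 : S.card * c ≤ (1 + C) * ∑ x, P x * f x * U x := by
    have := Finset.sum_le_sum h1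
    rw [Finset.sum_const, nsmul_eq_mul, ← Finset.mul_sum, Finset.sum_comm] at this
    simpa only [hU, Finset.mul_sum] using this
  have h3 : ∑ x, P x * U x ^ 2 ≤ 2 * (S.card : ℝ) ^ 2 := by
    have e1 : ∑ x, P x * U x ^ 2 = ∑ v ∈ S, ∑ u ∈ S, ∑ x, P x * (w v x * w u x) := by
      have : ∀ x, P x * U x ^ 2 = ∑ v ∈ S, ∑ u ∈ S, P x * (w v x * w u x) := fun x => by
        rw [hU, sq, Finset.sum_mul_sum, Finset.mul_sum]
        exact Finset.sum_congr rfl fun v _ => Finset.mul_sum _ _ _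
      rw [Finset.sum_congr rfl fun x _ => this x, Finset.sum_comm]
      exact Finset.sum_congr rfl fun v _ => Finset.sum_comm
    -- The diagonal terms are at most `|S|` each and the others at most 1, so both kinds contribute
    -- at most `|S|²` in total.
    have e2 : ∀ v ∈ S, ∀ u ∈ S,
        ∑ x, P x * (w v x * w u x) ≤ 1 + if v = u then (S.card : ℝ) else 0 := by
      intro v hv u hu
      split_ifs with h
      · subst h
        have : ∑ x, P x * (w v x * w v x) ≤ ∑ x, S.card * (P x * w v x) := by
          refine Finset.sum_le_sum fun x _ => ?_
          have := mul_le_mul_of_nonneg_left (hbound v hv x) (mul_nonneg (hP x) (hw v x))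
          linarith
        rw [← Finset.mul_sum] at this
        nlinarith [hup v hv]
      · simpa using hcross v hv u hu h
    rw [e1]
    refine (Finset.sum_le_sum fun v hv => Finset.sum_le_sum (e2 v hv)).trans (le_of_eq ?_)
    have e3 : ∀ v ∈ S, ∑ u ∈ S, ((1 : ℝ) + if v = u then (S.card : ℝ) else 0) = 2 * S.card := by
      intro v hv
      rw [Finset.sum_add_distrib, Finset.sum_ite_eq, if_pos hv]
      simp
      ring
    rw [Finset.sum_congr rfl e3]
    simp
    ring
  -- Cauchy-Schwarz, followed by `f² ≤ f` since `f` takes values in `[0, 1]`.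
  have h4 : (∑ x, P x * f x * U x) ^ 2 ≤ (∑ x, P x * f x) * ∑ x, P x * U x ^ 2 := by
    have e1 := Finset.sum_sq_le_sum_mul_sum_of_sq_le_mul Finset.univ
      (r := fun x => P x * f x * U x) (f := fun x => P x * f x ^ 2) (g := fun x => P x * U x ^ 2)
      (fun x _ => mul_nonneg (hP x) (sq_nonneg _)) (fun x _ => mul_nonneg (hP x) (sq_nonneg _))
      (fun x _ => le_of_eq (by ring))
    refine e1.trans (mul_le_mul_of_nonneg_right (Finset.sum_le_sum fun x _ => ?_)
      (Finset.sum_nonneg fun x _ => mul_nonneg (hP x) (sq_nonneg _)))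
    exact mul_le_mul_of_nonneg_left (by nlinarith [hf0 x, hf1 x]) (hP x)
  have hE : 0 ≤ ∑ x, P x * f x := Finset.sum_nonneg fun x _ => mul_nonneg (hP x) (hf0 x)
  have h5 : (S.card * c) ^ 2 ≤ (1 + C) ^ 2 * ((∑ x, P x * f x) * (2 * (S.card : ℝ) ^ 2)) := by
    calc (S.card * c) ^ 2 ≤ ((1 + C) * ∑ x, P x * f x * U x) ^ 2 :=
          pow_le_pow_left₀ (by positivity) h2 2
      _ = (1 + C) ^ 2 * (∑ x, P x * f x * U x) ^ 2 := by ring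
      _ ≤ _ := by
          refine mul_le_mul_of_nonneg_left (h4.trans ?_) (by positivity)
          exact mul_le_mul_of_nonneg_left h3 hE
  have h6 : (S.card : ℝ) ^ 2 * c ^ 2 ≤
      (S.card : ℝ) ^ 2 * (2 * (1 + C) ^ 2 * ∑ x, P x * f x) := by
    linarith
  exact le_of_mul_le_mul_left h6 (by positivity)

/-! ### Subsets with a prescribed colour profile. -/

/-- The number of subsets of `X` with prescribed numbers of elements of each colour. -/
theorem card_filter_colorProfile {α ι : Type*} [DecidableEq α] [DecidableEq ι] (X : Finset α)
    (M : Finset ι) (c : α → ι) (hc : ∀ a ∈ X, c a ∈ M) (x : ι → ℕ) :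
    (X.powerset.filter fun H => ∀ i ∈ M, (H.filter fun a => c a = i).card = x i).card =
      ∏ i ∈ M, (X.filter fun a => c a = i).card.choose (x i) := by
  have h1 : ∏ i ∈ M, (X.filter fun a => c a = i).card.choose (x i) =
      (M.pi fun i => (X.filter fun a => c a = i).powersetCard (x i)).card := by
    rw [Finset.card_pi]
    exact Finset.prod_congr rfl fun i _ => (Finset.card_powersetCard _ _).symm
  rw [h1]
  refine Finset.card_bij' (fun H _ => fun i _ => H.filter fun a => c a = i)
    (fun F _ => X.filter fun a => ∃ h : c a ∈ M, a ∈ F (c a) h) ?_ ?_ ?_ ?_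
  · intro H hH
    simp only [Finset.mem_filter, Finset.mem_powerset] at hH
    simp only [Finset.mem_pi, Finset.mem_powersetCard]
    exact fun i hi => ⟨Finset.filter_subset_filter _ hH.1, hH.2 i hi⟩
  · intro F hF
    simp only [Finset.mem_pi, Finset.mem_powersetCard] at hF
    simp only [Finset.mem_filter, Finset.mem_powerset]
    refine ⟨Finset.filter_subset _ _, fun i hi => ?_⟩
    rw [← (hF i hi).2]
    congr 1
    ext a
    simp only [Finset.mem_filter]
    constructor
    · rintro ⟨⟨_, h, h2⟩, rfl⟩
      exact h2
    · intro h
      have h2 := (hF i hi).1 h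
      simp only [Finset.mem_filter] at h2
      obtain ⟨h3, rfl⟩ := h2
      exact ⟨⟨h3, hi, h⟩, rfl⟩
  · intro H hH
    simp only [Finset.mem_filter, Finset.mem_powerset] at hH
    ext a
    simp only [Finset.mem_filter]
    exact ⟨fun h => h.2.2.1, fun h => ⟨hH.1 h, hc a (hH.1 h), h, trivial⟩⟩
  · intro F hF
    simp only [Finset.mem_pi, Finset.mem_powersetCard] at hF
    funext i hi
    ext a
    simp only [Finset.mem_filter]
    constructor
    · rintro ⟨⟨_, h, h2⟩, rfl⟩
      exact h2
    · intro h
      have h2 := (hF i hi).1 h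
      simp only [Finset.mem_filter] at h2
      obtain ⟨h3, rfl⟩ := h2
      exact ⟨⟨h3, hi, h⟩, rfl⟩

/-- When the rates depend only on the colour, all sets with a given profile are equally likely. The
law conditioned on the profile is therefore uniform, whatever the rates. -/
theorem bernWeight_of_colorProfile {α ι : Type*} [DecidableEq α] [DecidableEq ι] {X H : Finset α}
    {M : Finset ι} {c : α → ι} (hc : ∀ a ∈ X, c a ∈ M) {x : ι → ℕ} (hH : H ⊆ X)
    (hx : ∀ i ∈ M, (H.filter fun a => c a = i).card = x i) {q : α → ℝ} {r : ι → ℝ}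
    (hq : ∀ a ∈ X, q a = r (c a)) :
    bernWeight q X H =
      ∏ i ∈ M, r i ^ x i * (1 - r i) ^ ((X.filter fun a => c a = i).card - x i) := by
  unfold bernWeight
  rw [← Finset.prod_fiberwise_of_maps_to hc]
  refine Finset.prod_congr rfl fun i hi => ?_
  have h0 : (X.filter fun a => c a = i).filter (fun a => a ∈ H) = H.filter fun a => c a = i := by
    ext a
    simp only [Finset.mem_filter]
    exact ⟨fun h => ⟨h.2, h.1.2⟩, fun h => ⟨⟨hH h.1, h.2⟩, h.1⟩⟩
  have h1 : ∀ a ∈ X.filter fun a => c a = i,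
      (if a ∈ H then q a else 1 - q a) = if a ∈ H then r i else 1 - r i := by
    intro a ha
    simp only [Finset.mem_filter] at ha
    rw [hq a ha.1, ha.2]
  rw [Finset.prod_congr rfl h1, Finset.prod_ite, Finset.prod_const, Finset.prod_const, h0, hx i hi]
  congr 2
  have h2 := Finset.card_filter_add_card_filter_not (s := X.filter fun a => c a = i)
    (fun a => a ∈ H)
  rw [h0, hx i hi] at h2
  omega


/-! ### Binomial point probabilities and Poisson divergence. -/

/-- Stirling's bound up to a logarithmic term, by induction from `log (1 + 1 / x) ≥ 1 / (x + 1)`. -/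
theorem log_factorial_le {x : ℕ} (hx : 1 ≤ x) :
    Real.log (x.factorial : ℝ) ≤ x * Real.log x - x + Real.log x + 1 := by
  induction x, hx using Nat.le_induction with
  | base => simp
  | succ x hx ih =>
    have hx' : (0 : ℝ) < x := by exact_mod_cast hx
    rw [Nat.factorial_succ]
    push_cast
    rw [Real.log_mul (by positivity) (by positivity)]
    have h := Real.one_sub_inv_le_log_of_pos (x := ((x : ℝ) + 1) / x) (by positivity)
    rw [Real.log_div (by positivity) (by positivity), inv_div] at h
    have h2 : 1 - (x : ℝ) / (x + 1) = 1 / (x + 1) := by field_simp; ring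
    rw [h2] at h
    have h3 := mul_le_mul_of_nonneg_left h (show (0 : ℝ) ≤ x + 1 by positivity)
    rw [mul_one_div_cancel (by positivity)] at h3
    linarith

/-- The relative entropy of the Poisson law with mean `a` with respect to the one with mean `b`. -/
noncomputable def poissonDivergence (a b : ℝ) : ℝ :=
  b - a + a * Real.log (a / b)

/-- In the Poisson regime, where the mean is about `b L` and the rate tends to 0, a count of `⌊a L⌋`
costs the Poisson divergence times `L` in the exponent. Only the lower bound is needed, with slack
`η` absorbing terms of order `o(L)`. -/
theorem eventually_exp_le_binomial {ι : Type*} {l : Filter ι} {L q : ι → ℝ} {N : ι → ℕ}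
    {a b : ℝ} (hL : Tendsto L l atTop) (ha : 0 ≤ a) (hab : 0 < a → 0 < b)
    (hq0 : ∀ᶠ i in l, 0 ≤ q i) (hq : Tendsto q l (𝓝 0))
    (hN : Tendsto (fun i => N i * q i / L i) l (𝓝 b)) {η : ℝ} (hη : 0 < η) :
    ∀ᶠ i in l, Real.exp (-(L i * (poissonDivergence a b + η))) ≤
      (N i).choose ⌊a * L i⌋₊ * (q i ^ ⌊a * L i⌋₊ * (1 - q i) ^ (N i - ⌊a * L i⌋₊)) := by
  have hL0 : ∀ᶠ i in l, 0 < L i := hL.eventually_gt_atTop 0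
  have hq1 : ∀ᶠ i in l, q i < 1 := hq.eventually_lt_const one_pos
  have hNq : Tendsto (fun i => N i * (q i / (1 - q i)) / L i) l (𝓝 b) := by
    have := hN.div (hq.const_sub 1) (by norm_num)
    simp only [sub_zero, div_one] at this
    exact this.congr fun i => by simp only [Pi.div_apply]; ring
  have hlog : ∀ᶠ i in l, -(N i * (q i / (1 - q i))) ≤ N i * Real.log (1 - q i) := by
    filter_upwards [hq1] with i hi
    have h := Real.one_sub_inv_le_log_of_pos (sub_pos.2 hi)
    have h2 : 1 - (1 - q i)⁻¹ = -(q i / (1 - q i)) := by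
      have : 1 - q i ≠ 0 := (sub_pos.2 hi).ne'
      field_simp
      ring
    rw [h2] at h
    have := mul_le_mul_of_nonneg_left h (Nat.cast_nonneg (α := ℝ) (N i))
    linarith
  -- For `a = 0` the count is zero and only `(1 - q) ^ N` remains; `b` may then vanish too.
  rcases ha.eq_or_lt with rfl | ha
  · have h1 : ∀ᶠ i in l, N i * (q i / (1 - q i)) / L i < b + η :=
      hNq.eventually_lt_const (by linarith)
    filter_upwards [h1, hL0, hq1, hlog] with i h1 h2 h3 h4
    rw [div_lt_iff₀ h2] at h1
    simp only [zero_mul, Nat.floor_zero, Nat.choose_zero_right, pow_zero, Nat.cast_one, one_mul,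
      Nat.sub_zero, poissonDivergence, sub_zero, add_zero]
    rw [← Real.exp_log (sub_pos.2 h3), ← Real.exp_nat_mul]
    exact Real.exp_le_exp.2 (by linarith)
  · have hb := hab ha
    set x : ι → ℕ := fun i => ⌊a * L i⌋₊ with hx
    have hxL : Tendsto (fun i => (x i : ℝ) / L i) l (𝓝 a) :=
      (tendsto_nat_floor_mul_div_atTop ha.le).comp hL
    have hxtop : Tendsto (fun i => (x i : ℝ)) l atTop :=
      (hxL.pos_mul_atTop ha hL).congr' <| by
        filter_upwards [hL0] with i hi using div_mul_cancel₀ _ hi.ne'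
    have hlogx : Tendsto (fun i => Real.log (x i) / L i) l (𝓝 0) := by
      have h1 := (Real.isLittleO_log_id_atTop.tendsto_div_nhds_zero.comp hxtop).mul hxL
      simp only [zero_mul] at h1
      refine h1.congr' ?_
      filter_upwards [hxtop.eventually_gt_atTop 0] with i hi
      simp only [Function.comp, id]
      field_simp
    have hNx : Tendsto (fun i => ((N i : ℝ) - x i) * q i / L i) l (𝓝 b) := by
      have := hN.sub (hxL.mul hq)
      simp only [mul_zero, sub_zero] at this
      exact this.congr fun i => by ring
    have hratio : Tendsto (fun i => ((N i : ℝ) - x i) * q i / x i) l (𝓝 (b / a)) := by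
      refine (hNx.div hxL ha.ne').congr' ?_
      filter_upwards [hL0] with i hi
      exact div_div_div_cancel_right₀ hi.ne' _ _
    -- This is a lower bound for the exponent divided by `L`: a binomial coefficient at least `(N -
    -- x) ^ x / x!`, then Stirling, then `log (1 - q) ≥ -q / (1 - q)`.
    have hB : Tendsto (fun i => (x i : ℝ) / L i * Real.log (((N i : ℝ) - x i) * q i / x i)
        + (x i : ℝ) / L i - Real.log (x i) / L i - 1 / L i - N i * (q i / (1 - q i)) / L i) l
        (𝓝 (-poissonDivergence a b)) := by
      have := ((((hxL.mul (hratio.log (div_pos hb ha).ne')).add hxL).sub hlogx).sub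
        (hL.const_div_atTop 1)).sub hNq
      convert this using 2
      rw [poissonDivergence, Real.log_div ha.ne' hb.ne', Real.log_div hb.ne' ha.ne']
      ring
    filter_upwards [hB.eventually_const_lt (show -(poissonDivergence a b + η) < _ by linarith), hL0,
      hq0, hq1, hlog, hNx.eventually_const_lt hb, hxtop.eventually_ge_atTop 1]
      with i h1 hLi hq0 hq1 hlog hNx hx1
    have hpos : 0 < ((N i : ℝ) - x i) * q i := by
      by_contra h
      exact absurd hNx (not_lt.2 (div_nonpos_of_nonpos_of_nonneg (not_lt.1 h) hLi.le))
    have hq' : 0 < q i := hq0.lt_of_ne fun h => by simp [← h] at hpos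
    have hNx' : 0 < (N i : ℝ) - x i := pos_of_mul_pos_left hpos hq0
    have hle : x i ≤ N i := by
      have : (x i : ℝ) < N i := by linarith
      exact_mod_cast this.le
    have hx0 : (0 : ℝ) < x i := by linarith
    have h2 : ((N i : ℝ) - x i) ^ x i / (x i).factorial ≤ (N i).choose (x i) := by
      refine le_trans ?_ (Nat.pow_le_choose (α := ℝ) (x i) (N i))
      refine div_le_div_of_nonneg_right (pow_le_pow_left₀ hNx'.le ?_ _) (by positivity)
      rw [Nat.cast_sub (by omega)]
      push_cast
      linarith
    have h3 : (1 - q i) ^ N i ≤ (1 - q i) ^ (N i - x i) :=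
      pow_le_pow_of_le_one (by linarith) (by linarith) (Nat.sub_le _ _)
    refine le_trans ?_ (mul_le_mul h2 (mul_le_mul_of_nonneg_left h3 (pow_nonneg hq0 _))
      (mul_nonneg (pow_nonneg hq0 _) (pow_nonneg (by linarith) _)) (Nat.cast_nonneg _))
    have h4 : ((N i : ℝ) - x i) ^ x i / (x i).factorial * (q i ^ x i * (1 - q i) ^ N i) =
        Real.exp (x i * Real.log (((N i : ℝ) - x i) * q i) - Real.log (x i).factorial
          + N i * Real.log (1 - q i)) := by
      rw [Real.exp_add, Real.exp_sub, Real.exp_nat_mul, Real.exp_nat_mul, Real.exp_log hpos,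
        Real.exp_log (sub_pos.2 hq1), Real.exp_log (by positivity), mul_pow]
      ring
    rw [h4]
    refine Real.exp_le_exp.2 ?_
    have h5 := log_factorial_le (x := x i) (by exact_mod_cast hx1)
    rw [Real.log_div hpos.ne' hx0.ne'] at h1
    have h6 := mul_lt_mul_of_pos_left h1 hLi
    have h7 : L i * ((x i : ℝ) / L i * (Real.log (((N i : ℝ) - x i) * q i) - Real.log (x i))
        + (x i : ℝ) / L i - Real.log (x i) / L i - 1 / L i - N i * (q i / (1 - q i)) / L i) =
        x i * (Real.log (((N i : ℝ) - x i) * q i) - Real.log (x i)) + x i - Real.log (x i) - 1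
          - N i * (q i / (1 - q i)) := by
      have := hLi.ne'
      have : 1 - q i ≠ 0 := by linarith
      field_simp
    linarith

/-! ### The balanced intermediate profile. -/

/-- A profile whose divergences from two given profiles are both at most their generalized
Chernoff-Hellinger divergence. -/
theorem exists_balanced_profile {ι : Type*} (M : Finset ι) (a b : ι → ℝ)
    (ha : ∀ m ∈ M, 0 ≤ a m) (hb : ∀ m ∈ M, 0 ≤ b m) {D : ℝ}
    (hD : ∀ t ∈ Set.Ioo (0 : ℝ) 1,
      ∑ m ∈ M, (t * a m + (1 - t) * b m - a m ^ t * b m ^ (1 - t)) ≤ D) :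
    ∃ τ : ι → ℝ, (∀ m, 0 ≤ τ m) ∧ (∀ m ∈ M, 0 < τ m → 0 < a m ∧ 0 < b m) ∧
      ∑ m ∈ M, poissonDivergence (τ m) (a m) ≤ D ∧
      ∑ m ∈ M, poissonDivergence (τ m) (b m) ≤ D := by
  classical
  -- The term `a ^ t * b ^ (1 - t)`, set to zero throughout when `a` or `b` vanishes. This makes the
  -- objective differentiable at the end points, where the convention for `0 ^ 0` would break
  -- continuity.
  set e : ι → ℝ → ℝ := fun m t =>
    if 0 < a m ∧ 0 < b m then Real.exp (t * Real.log (a m) + (1 - t) * Real.log (b m)) else 0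
    with he
  set f : ℝ → ℝ := fun t => ∑ m ∈ M, (t * a m + (1 - t) * b m - e m t) with hf
  set f' : ℝ → ℝ := fun t => ∑ m ∈ M, (a m - b m - e m t * (Real.log (a m) - Real.log (b m)))
    with hf'
  have hder : ∀ t, HasDerivAt f (f' t) t := by
    intro t
    refine HasDerivAt.fun_sum fun m _ => HasDerivAt.sub ?_ ?_
    · exact (((hasDerivAt_id' t).mul_const (a m)).fun_add
        (((hasDerivAt_id' t).const_sub 1).mul_const (b m))).congr_deriv (by ring)
    · simp only [he]
      split_ifs
      · exact (((hasDerivAt_id' t).mul_const (Real.log (a m))).fun_add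
          (((hasDerivAt_id' t).const_sub 1).mul_const (Real.log (b m)))).exp.congr_deriv (by ring)
      · simpa using hasDerivAt_const t (0 : ℝ)
  have hcont : Continuous f := continuous_iff_continuousAt.2 fun t => (hder t).continuousAt
  have hfD : ∀ t ∈ Set.Icc (0 : ℝ) 1, f t ≤ D := by
    intro t ht
    rw [← closure_Ioo (zero_ne_one' ℝ)] at ht
    refine closure_minimal (s := Set.Ioo (0 : ℝ) 1) (t := {t | f t ≤ D}) ?_
      (isClosed_le hcont continuous_const) ht
    intro t ht
    refine le_trans (le_of_eq (Finset.sum_congr rfl fun m hm => ?_)) (hD t ht)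
    simp only [he]
    split_ifs with h
    · rw [Real.exp_add, Real.rpow_def_of_pos h.1, Real.rpow_def_of_pos h.2,
        mul_comm t (Real.log _), mul_comm (1 - t) (Real.log _)]
    · rcases not_and_or.1 h with h | h
      · rw [le_antisymm (not_lt.1 h) (ha m hm), Real.zero_rpow ht.1.ne', zero_mul]
      · rw [le_antisymm (not_lt.1 h) (hb m hm), Real.zero_rpow (sub_pos.2 ht.2).ne', mul_zero, mul_zero]
  obtain ⟨t, ht, hmax⟩ := isCompact_Icc.exists_isMaxOn (Set.nonempty_Icc.2 zero_le_one)
    hcont.continuousOn (s := Set.Icc (0 : ℝ) 1)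
  -- First-order optimality at the maximiser, in a form that also covers a maximum at an end point.
  have hslope : ∀ y ∈ Set.Icc (0 : ℝ) 1, (y - t) * f' t ≤ 0 := by
    intro y hy
    have := hmax.localize.hasFDerivWithinAt_nonpos (hder t).hasFDerivAt.hasFDerivWithinAt
      (sub_mem_posTangentConeAt_of_segment_subset ((convex_Icc (0 : ℝ) 1).segment_subset ht hy))
    simpa using this
  have h0 := hslope 0 (by simp)
  have h1 := hslope 1 (by simp)
  have hDt := hfD t ht
  have hlog : ∀ m, e m t ≠ 0 → 0 < a m ∧ 0 < b m ∧
      Real.log (e m t) = t * Real.log (a m) + (1 - t) * Real.log (b m) := by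
    intro m hm
    simp only [he] at hm ⊢
    split_ifs at hm ⊢ with h
    · exact ⟨h.1, h.2, Real.log_exp _⟩
    · exact absurd rfl hm
  refine ⟨fun m => e m t, fun m => ?_, fun m _ hm => ?_, ?_, ?_⟩
  · simp only [he]
    split_ifs
    · exact (Real.exp_pos _).le
    · exact le_rfl
  · exact ⟨(hlog m hm.ne').1, (hlog m hm.ne').2.1⟩
  -- The divergence from `a` is the value at 1 of the tangent line to `f` at `t`, and the one from
  -- `b` its value at 0. By optimality neither exceeds `f t`.
  · have : ∑ m ∈ M, poissonDivergence (e m t) (a m) = f t + (1 - t) * f' t := by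
      simp only [hf, hf', Finset.mul_sum, ← Finset.sum_add_distrib]
      refine Finset.sum_congr rfl fun m _ => ?_
      unfold poissonDivergence
      rcases eq_or_ne (e m t) 0 with h | h
      · rw [h]; ring
      · rw [Real.log_div h (hlog m h).1.ne', (hlog m h).2.2]
        ring
    linarith
  · have : ∑ m ∈ M, poissonDivergence (e m t) (b m) = f t + (0 - t) * f' t := by
      simp only [hf, hf', Finset.mul_sum, ← Finset.sum_add_distrib]
      refine Finset.sum_congr rfl fun m _ => ?_
      unfold poissonDivergence
      rcases eq_or_ne (e m t) 0 with h | h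
      · rw [h]; ring
      · rw [Real.log_div h (hlog m h).2.1.ne', (hlog m h).2.2]
        ring
    linarith


/-! ### Concentration of community sizes. -/

section Labels

variable {n k : ℕ} {p : Fin k → ℝ}

theorem labelProb_nonneg (hp : ∀ i, 0 ≤ p i) (z : Labeling n k) : 0 ≤ labelProb p z :=
  Finset.prod_nonneg fun _ _ => hp _

theorem sum_labelProb_mul_prod (p : Fin k → ℝ) (h : Fin n → Fin k → ℝ) :
    ∑ z : Labeling n k, labelProb p z * ∏ v, h v (z v) = ∏ v, ∑ i, p i * h v i := by
  rw [Finset.prod_univ_sum, Fintype.piFinset_univ]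
  refine Finset.sum_congr rfl fun z _ => ?_
  rw [labelProb, Finset.prod_mul_distrib]

theorem sum_labelProb (hp : ∑ i, p i = 1) : ∑ z : Labeling n k, labelProb p z = 1 := by
  simpa [hp] using sum_labelProb_mul_prod (n := n) p (fun _ _ => 1)

theorem sum_labelProb_mul (hp : ∑ i, p i = 1) (v : Fin n) (g : Fin k → ℝ) :
    ∑ z : Labeling n k, labelProb p z * g (z v) = ∑ i, p i * g i := by
  have h := sum_labelProb_mul_prod (n := n) p (fun u i => if u = v then g i else 1)
  simp only [Finset.prod_ite_eq', Finset.mem_univ, if_true] at h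
  rw [h, Finset.prod_eq_single v]
  · simp
  · intro u _ hu
    simp [hu, hp]
  · simp

theorem sum_labelProb_mul_mul (hp : ∑ i, p i = 1) {u v : Fin n} (huv : u ≠ v) (g : Fin k → ℝ) :
    ∑ z : Labeling n k, labelProb p z * (g (z u) * g (z v)) = (∑ i, p i * g i) ^ 2 := by
  have h := sum_labelProb_mul_prod (n := n) p
    (fun w i => (if w = u then g i else 1) * if w = v then g i else 1)
  simp only [Finset.prod_mul_distrib, Finset.prod_ite_eq', Finset.mem_univ, if_true] at h
  rw [h, ← Finset.mul_prod_erase _ _ (Finset.mem_univ u),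
    ← Finset.mul_prod_erase _ _ (Finset.mem_erase.2 ⟨huv.symm, Finset.mem_univ v⟩),
    Finset.prod_eq_one]
  · simp [huv, huv.symm, sq]
  · intro w hw
    simp only [Finset.mem_erase] at hw
    simp [hw.1, hw.2.1, hp]

/-- The variance of a sum of independent centred variables bounded by 1: the off-diagonal terms
vanish. -/
theorem sum_labelProb_mul_sq_le (hp0 : ∀ i, 0 ≤ p i) (hp : ∑ i, p i = 1) (O : Finset (Fin n))
    {g : Fin k → ℝ} (hg : ∑ i, p i * g i = 0) (hg1 : ∀ i, |g i| ≤ 1) :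
    ∑ z : Labeling n k, labelProb p z * (∑ v ∈ O, g (z v)) ^ 2 ≤ O.card := by
  have h1 : ∀ z : Labeling n k, labelProb p z * (∑ v ∈ O, g (z v)) ^ 2 =
      ∑ u ∈ O, ∑ v ∈ O, labelProb p z * (g (z u) * g (z v)) := fun z => by
    rw [sq, Finset.sum_mul_sum, Finset.mul_sum]
    exact Finset.sum_congr rfl fun u _ => Finset.mul_sum _ _ _
  rw [Finset.sum_congr rfl fun z _ => h1 z, Finset.sum_comm]
  have h2 : ∀ u ∈ O, ∑ z : Labeling n k, ∑ v ∈ O, labelProb p z * (g (z u) * g (z v)) ≤ 1 := by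
    intro u hu
    rw [Finset.sum_comm, Finset.sum_eq_single_of_mem u hu]
    · rw [← sum_labelProb (n := n) hp]
      refine Finset.sum_le_sum fun z _ => mul_le_of_le_one_right (labelProb_nonneg hp0 z) ?_
      have := abs_le.1 (hg1 (z u))
      nlinarith
    · intro v _ hv
      rw [sum_labelProb_mul_mul hp hv.symm, hg, sq, zero_mul]
  simpa using Finset.sum_le_sum h2

/-- The community vectors whose community sizes within `O` are within `δ` of their means. -/
noncomputable def typicalLabelings (p : Fin k → ℝ) (O : Finset (Fin n)) (δ : ℝ) :
    Finset (Labeling n k) :=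
  Finset.univ.filter fun z => ∀ s, |((O.filter fun v => z v = s).card : ℝ) - O.card * p s| ≤ δ

/-- Chebyshev's inequality for each community size and a union bound over the `k` communities. -/
theorem sum_labelProb_compl_typicalLabelings_le (hp0 : ∀ i, 0 ≤ p i) (hp : ∑ i, p i = 1)
    (O : Finset (Fin n)) {δ : ℝ} (hδ : 0 < δ) :
    ∑ z ∈ (typicalLabelings p O δ)ᶜ, labelProb p z ≤ k * n / δ ^ 2 := by
  have hcard : (O.card : ℝ) ≤ n := by
    exact_mod_cast (Finset.card_le_univ O).trans_eq (Fintype.card_fin n)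
  have hp1 : ∀ i, p i ≤ 1 := fun i =>
    hp ▸ Finset.single_le_sum (fun j _ => hp0 j) (Finset.mem_univ i)
  set g : Fin k → Fin k → ℝ := fun s i => (if i = s then 1 else 0) - p s with hg
  have h1 : ∀ s, ∑ z : Labeling n k, labelProb p z * (∑ v ∈ O, g s (z v)) ^ 2 ≤ n := fun s => by
    refine (sum_labelProb_mul_sq_le hp0 hp O ?_ fun i => ?_).trans hcard
    · simp [hg, mul_sub, ← Finset.sum_mul, hp]
    · simp only [hg, abs_le]
      split_ifs <;> constructor <;> linarith [hp0 s, hp1 s]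
  have h2 : ∀ (z : Labeling n k) s,
      ∑ v ∈ O, g s (z v) = ((O.filter fun v => z v = s).card : ℝ) - O.card * p s := by
    intro z s
    simp [hg, Finset.sum_sub_distrib, Finset.sum_boole]
  have h3 : ∀ z ∈ (typicalLabelings p O δ)ᶜ,
      labelProb p z * δ ^ 2 ≤ ∑ s, labelProb p z * (∑ v ∈ O, g s (z v)) ^ 2 := by
    intro z hz
    simp only [typicalLabelings, Finset.mem_compl, Finset.mem_filter, Finset.mem_univ, true_and,
      not_forall, not_le] at hz
    obtain ⟨s, hs⟩ := hz
    refine le_trans ?_ (Finset.single_le_sum (f := fun s => labelProb p z * (∑ v ∈ O, g s (z v)) ^ 2)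
      (fun s _ => mul_nonneg (labelProb_nonneg hp0 z) (sq_nonneg _)) (Finset.mem_univ s))
    refine mul_le_mul_of_nonneg_left ?_ (labelProb_nonneg hp0 z)
    rw [h2, ← sq_abs (_ - _)]
    exact pow_le_pow_left₀ hδ.le hs.le 2
  rw [le_div_iff₀ (by positivity), Finset.sum_mul]
  calc ∑ z ∈ (typicalLabelings p O δ)ᶜ, labelProb p z * δ ^ 2
      ≤ ∑ z ∈ (typicalLabelings p O δ)ᶜ, ∑ s, labelProb p z * (∑ v ∈ O, g s (z v)) ^ 2 :=
        Finset.sum_le_sum h3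
    _ ≤ ∑ z, ∑ s, labelProb p z * (∑ v ∈ O, g s (z v)) ^ 2 :=
        Finset.sum_le_sum_of_subset_of_nonneg (Finset.subset_univ _) fun z _ _ =>
          Finset.sum_nonneg fun s _ => mul_nonneg (labelProb_nonneg hp0 z) (sq_nonneg _)
    _ = ∑ s, ∑ z, labelProb p z * (∑ v ∈ O, g s (z v)) ^ 2 := Finset.sum_comm
    _ ≤ ∑ s : Fin k, (n : ℝ) := Finset.sum_le_sum fun s _ => h1 s
    _ = k * n := by simp

/-- The probability that `v` has label `i` and the community vector is typical. -/
theorem le_sum_typicalLabelings (hp0 : ∀ i, 0 ≤ p i) (hp : ∑ i, p i = 1)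
    (O : Finset (Fin n)) {δ : ℝ} (hδ : 0 < δ) (v : Fin n) (i : Fin k) :
    p i - k * n / δ ^ 2 ≤
      ∑ z ∈ (typicalLabelings p O δ).filter fun z => z v = i, labelProb p z := by
  have h1 := sum_labelProb_compl_typicalLabelings_le (n := n) hp0 hp O hδ
  have h2 : ∑ z : Labeling n k, (if z v = i then labelProb p z else 0) = p i := by
    simpa using sum_labelProb_mul (n := n) hp v (fun l => if l = i then 1 else 0)
  rw [← Finset.sum_add_sum_compl (typicalLabelings p O δ)] at h2
  have h3 : ∑ z ∈ (typicalLabelings p O δ)ᶜ, (if z v = i then labelProb p z else 0) ≤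
      ∑ z ∈ (typicalLabelings p O δ)ᶜ, labelProb p z :=
    Finset.sum_le_sum fun z _ => by
      split_ifs
      · exact le_rfl
      · exact labelProb_nonneg hp0 z
  rw [Finset.sum_filter]
  linarith

end Labels


/-! ### Hyperedges at a node of `S` and the exchange of two labels. -/

section Model

variable {n k d : ℕ}

/-- The hyperedges whose only node in `S` is `v`. -/
def exclusiveEdges (d : ℕ) (S : Finset (Fin n)) (v : Fin n) : Finset (Hyperedge n d) :=
  Finset.univ.filter fun e => e.1 ∩ S = {v}

/-- The hyperedges that contain `v` and another node of `S`. -/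
def sharedEdges (d : ℕ) (S : Finset (Fin n)) (v : Fin n) : Finset (Hyperedge n d) :=
  Finset.univ.filter fun e => v ∈ e.1 ∧ ∃ u ∈ S, u ≠ v ∧ u ∈ e.1

/-- The community assignment of the nodes of `e` other than `v`. -/
def neighborType (z : Labeling n k) (v : Fin n) (e : Hyperedge n d) : Fin k → ℕ :=
  fun s => ((e.1.erase v).filter fun u => z u = s).card

/-- The sets of exclusive hyperedges at `v` with `x m` elements of each neighbour type `m`. -/
def profileConfigs (S : Finset (Fin n)) (z : Labeling n k) (v : Fin n) (x : (Fin k → ℕ) → ℕ) :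
    Finset (Finset (Hyperedge n d)) :=
  (exclusiveEdges d S v).powerset.filter fun H =>
    ∀ m ∈ neighborAssignments k d, (H.filter fun e => neighborType z v e = m).card = x m

/-- The probability of a hyperedge that consists of a node of community `i` and of `d - 1` nodes
with community assignment `m`. -/
noncomputable def typeProb (Q : (Fin k → ℕ) → ℝ) (d n : ℕ) (i : Fin k) (m : Fin k → ℕ) : ℝ :=
  min 1 (Q (addNode m i) * Real.log n / (n : ℝ) ^ (d - 1))

/-- The number of `(d - 1)`-sets of nodes outside `S` with community assignment `m`. -/
def typeCount (S : Finset (Fin n)) (z : Labeling n k) (m : Fin k → ℕ) : ℕ :=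
  ∏ s, (Sᶜ.filter fun u => z u = s).card.choose (m s)

/-- Exchange of the labels `i` and `j` at the node `v`. -/
def relabel (i j : Fin k) (v : Fin n) (z : Labeling n k) : Labeling n k :=
  Function.update z v (Equiv.swap i j (z v))

variable {S : Finset (Fin n)} {z : Labeling n k} {v : Fin n} {i j : Fin k}

theorem relabel_involutive (i j : Fin k) (v : Fin n) : Function.Involutive (relabel i j v) := by
  intro z
  simp [relabel]

theorem relabel_self : relabel i j v z v = Equiv.swap i j (z v) := by
  simp [relabel]

theorem relabel_of_ne {u : Fin n} (h : u ≠ v) : relabel i j v z u = z u := by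
  simp [relabel, h]

theorem neighborType_relabel (e : Hyperedge n d) :
    neighborType (relabel i j v z) v e = neighborType z v e := by
  funext s
  unfold neighborType
  congr 1
  refine Finset.filter_congr fun u hu => ?_
  rw [relabel_of_ne (Finset.ne_of_mem_erase hu)]

theorem profileConfigs_relabel (x : (Fin k → ℕ) → ℕ) :
    profileConfigs (d := d) S (relabel i j v z) v x = profileConfigs S z v x := by
  simp only [profileConfigs, neighborType_relabel]

theorem filter_relabel {O : Finset (Fin n)} (hv : v ∉ O) (s : Fin k) :
    (O.filter fun u => relabel i j v z u = s) = O.filter fun u => z u = s :=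
  Finset.filter_congr fun u hu => by rw [relabel_of_ne (ne_of_mem_of_not_mem hu hv)]

/-- Typicality is tested only on `O`, taken later as the complement of `S`, so that label exchanges
at nodes of `S` preserve it. -/
theorem relabel_mem_typicalLabelings {p : Fin k → ℝ} {O : Finset (Fin n)} {δ : ℝ} (hv : v ∉ O)
    (hz : z ∈ typicalLabelings p O δ) : relabel i j v z ∈ typicalLabelings p O δ := by
  simpa only [typicalLabelings, Finset.mem_filter, Finset.mem_univ, true_and, filter_relabel hv]
    using hz

theorem mem_of_mem_exclusiveEdges {e : Hyperedge n d} (h : e ∈ exclusiveEdges d S v) :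
    v ∈ e.1 := by
  simp only [exclusiveEdges, Finset.mem_filter, Finset.mem_univ, true_and] at h
  have : v ∈ e.1 ∩ S := h ▸ Finset.mem_singleton_self v
  exact (Finset.mem_inter.1 this).1

theorem mem_exclusiveEdges_or_mem_sharedEdges {e : Hyperedge n d} (hv : v ∈ S) (he : v ∈ e.1) :
    e ∈ exclusiveEdges d S v ∨ e ∈ sharedEdges d S v := by
  simp only [exclusiveEdges, sharedEdges, Finset.mem_filter, Finset.mem_univ, true_and]
  by_cases h : ∃ u ∈ S, u ≠ v ∧ u ∈ e.1
  · exact Or.inr ⟨he, h⟩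
  · refine Or.inl ?_
    ext u
    simp only [Finset.mem_inter, Finset.mem_singleton]
    constructor
    · rintro ⟨h1, h2⟩
      by_contra h3
      exact h ⟨u, h2, h3, h1⟩
    · rintro rfl
      exact ⟨he, hv⟩

theorem disjoint_exclusiveEdges_sharedEdges :
    Disjoint (exclusiveEdges d S v) (sharedEdges d S v) := by
  rw [Finset.disjoint_left]
  intro e h1 h2
  simp only [exclusiveEdges, sharedEdges, Finset.mem_filter, Finset.mem_univ, true_and] at h1 h2
  obtain ⟨_, u, hu, huv, hue⟩ := h2
  have : u ∈ e.1 ∩ S := Finset.mem_inter.2 ⟨hue, hu⟩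
  rw [h1] at this
  exact huv (Finset.mem_singleton.1 this)

theorem disjoint_exclusiveEdges {u : Fin n} (h : v ≠ u) :
    Disjoint (exclusiveEdges d S v) (exclusiveEdges d S u) := by
  rw [Finset.disjoint_left]
  intro e h1 h2
  simp only [exclusiveEdges, Finset.mem_filter, Finset.mem_univ, true_and] at h1 h2
  exact h (Finset.singleton_injective (h1.symm.trans h2))

theorem neighborType_mem {e : Hyperedge n d} (he : v ∈ e.1) :
    neighborType z v e ∈ neighborAssignments k d := by
  simp only [neighborAssignments, Finset.mem_piAntidiag, Finset.mem_univ, implies_true, and_true]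
  unfold neighborType
  rw [← Finset.card_eq_sum_card_fiberwise (fun u _ => Finset.mem_coe.2 (Finset.mem_univ (z u))),
    Finset.card_erase_of_mem he, e.2]

theorem sum_assignment (z : Labeling n k) (e : Hyperedge n d) : ∑ s, assignment z e s = d := by
  unfold assignment
  rw [← Finset.card_eq_sum_card_fiberwise (fun v _ => Finset.mem_coe.2 (Finset.mem_univ (z v)))]
  exact e.2

theorem assignment_eq_addNode {e : Hyperedge n d} (he : v ∈ e.1) :
    assignment z e = addNode (neighborType z v e) (z v) := by
  funext s
  simp only [assignment, addNode, neighborType, Pi.add_apply]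
  conv_lhs => rw [← Finset.insert_erase he]
  rw [Finset.filter_insert]
  split_ifs with h
  · rw [Finset.card_insert_of_notMem (by simp), ← h, Pi.single_eq_same]
  · rw [Pi.single_eq_of_ne (Ne.symm h), add_zero]

theorem edgeProb_eq_typeProb (Q : (Fin k → ℕ) → ℝ) {e : Hyperedge n d} (he : v ∈ e.1) :
    edgeProb Q z e = typeProb Q d n (z v) (neighborType z v e) := by
  rw [edgeProb, typeProb, assignment_eq_addNode he]

theorem edgeProb_relabel (Q : (Fin k → ℕ) → ℝ) {e : Hyperedge n d} (he : v ∉ e.1) :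
    edgeProb Q (relabel i j v z) e = edgeProb Q z e := by
  have : assignment (relabel i j v z) e = assignment z e := by
    funext s
    rw [assignment, assignment, filter_relabel he]
  rw [edgeProb, edgeProb, this]

theorem edgeProb_nonneg {Q : (Fin k → ℕ) → ℝ} (hQ : ∀ T : Fin k → ℕ, ∑ i, T i = d → 0 ≤ Q T)
    (z : Labeling n k) (e : Hyperedge n d) : 0 ≤ edgeProb Q z e :=
  le_min zero_le_one (div_nonneg (mul_nonneg (hQ _ (sum_assignment z e))
    (Real.log_natCast_nonneg n)) (by positivity))

theorem edgeProb_le_one (Q : (Fin k → ℕ) → ℝ) (z : Labeling n k) (e : Hyperedge n d) :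
    edgeProb Q z e ≤ 1 := min_le_left _ _

theorem graphProb_eq_bernWeight (Q : (Fin k → ℕ) → ℝ) (z : Labeling n k) (G : Hypergraph n d) :
    graphProb Q z G = bernWeight (edgeProb Q z) Finset.univ G := rfl

/-- Erasing `v` identifies its exclusive hyperedges with the `(d - 1)`-sets outside `S`. Hence the
count involves neither the label of `v` nor any other label in `S`. -/
theorem card_filter_neighborType (hv : v ∈ S) (hd : 1 ≤ d) {m : Fin k → ℕ}
    (hm : m ∈ neighborAssignments k d) :
    ((exclusiveEdges d S v).filter fun e => neighborType z v e = m).card = typeCount S z m := by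
  have hsum : ∑ s, m s = d - 1 := (Finset.mem_piAntidiag.1 hm).1
  have h := card_filter_colorProfile Sᶜ (Finset.univ : Finset (Fin k)) z (fun _ _ =>
    Finset.mem_univ _) m
  rw [typeCount, ← h]
  have hcard : ∀ F : Finset (Fin n), (∀ s, (F.filter fun u => z u = s).card = m s) →
      F.card = d - 1 := by
    intro F hF
    rw [← hsum, Finset.card_eq_sum_card_fiberwise
      (fun u _ => Finset.mem_coe.2 (Finset.mem_univ (z u)))]
    exact Finset.sum_congr rfl fun s _ => hF s
  have hmem : ∀ F : Finset (Fin n), F ⊆ Sᶜ → v ∉ F := fun F hF hvF =>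
    Finset.mem_compl.1 (hF hvF) hv
  refine Finset.card_bij' (fun e _ => e.1.erase v) (fun F hF => ⟨insert v F, ?_⟩) ?_ ?_ ?_ ?_
  · simp only [Finset.mem_filter, Finset.mem_powerset, Finset.mem_univ, true_implies] at hF
    rw [Finset.card_insert_of_notMem (hmem F hF.1), hcard F hF.2]
    omega
  · intro e he
    simp only [Finset.mem_filter, Finset.mem_powerset, Finset.mem_univ, true_implies] at he ⊢
    refine ⟨fun u hu => ?_, fun s => congrFun he.2 s⟩
    have h1 := he.1
    simp only [exclusiveEdges, Finset.mem_filter, Finset.mem_univ, true_and] at h1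
    rw [Finset.mem_compl]
    intro hS
    have : u ∈ e.1 ∩ S := Finset.mem_inter.2 ⟨Finset.mem_of_mem_erase hu, hS⟩
    rw [h1] at this
    exact Finset.ne_of_mem_erase hu (Finset.mem_singleton.1 this)
  · intro F hF
    simp only [Finset.mem_filter, Finset.mem_powerset, Finset.mem_univ, true_implies] at hF
    simp only [exclusiveEdges, Finset.mem_filter, Finset.mem_univ, true_and]
    constructor
    · rw [Finset.insert_inter_of_mem hv, Finset.disjoint_iff_inter_eq_empty.1
        (disjoint_compl_left.mono_left hF.1)]
      rfl
    · funext s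
      rw [neighborType, Finset.erase_insert (hmem F hF.1)]
      exact hF.2 s
  · intro e he
    simp only [Finset.mem_filter] at he
    exact Subtype.ext (Finset.insert_erase (mem_of_mem_exclusiveEdges he.1))
  · intro F hF
    simp only [Finset.mem_filter, Finset.mem_powerset] at hF
    exact Finset.erase_insert (hmem F hF.1)

theorem card_profileConfigs (hv : v ∈ S) (hd : 1 ≤ d) (x : (Fin k → ℕ) → ℕ) :
    (profileConfigs (d := d) S z v x).card =
      ∏ m ∈ neighborAssignments k d, (typeCount S z m).choose (x m) := by
  rw [profileConfigs, card_filter_colorProfile _ _ _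
    (fun e he => neighborType_mem (mem_of_mem_exclusiveEdges he))]
  exact Finset.prod_congr rfl fun m hm => by rw [card_filter_neighborType hv hd hm]

theorem bernWeight_of_mem_profileConfigs (Q : (Fin k → ℕ) → ℝ) (hv : v ∈ S) (hd : 1 ≤ d)
    {x : (Fin k → ℕ) → ℕ} {H : Finset (Hyperedge n d)} (hH : H ∈ profileConfigs S z v x) :
    bernWeight (edgeProb Q z) (exclusiveEdges d S v) H = ∏ m ∈ neighborAssignments k d,
      typeProb Q d n (z v) m ^ x m * (1 - typeProb Q d n (z v) m) ^ (typeCount S z m - x m) := by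
  simp only [profileConfigs, Finset.mem_filter, Finset.mem_powerset] at hH
  rw [bernWeight_of_colorProfile
    (fun e he => neighborType_mem (z := z) (mem_of_mem_exclusiveEdges he)) hH.1 hH.2
    (fun e he => edgeProb_eq_typeProb Q (mem_of_mem_exclusiveEdges he))]
  exact Finset.prod_congr rfl fun m hm => by rw [card_filter_neighborType hv hd hm]

theorem card_filter_mem_mem_le (hd : 2 ≤ d) {u : Fin n} (h : u ≠ v) :
    ((Finset.univ : Finset (Hyperedge n d)).filter fun e => v ∈ e.1 ∧ u ∈ e.1).card ≤
      n ^ (d - 2) := by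
  have h1 : ((Finset.univ : Finset (Fin n)).powersetCard (d - 2)).card ≤ n ^ (d - 2) := by
    rw [Finset.card_powersetCard, Finset.card_univ, Fintype.card_fin]
    exact Nat.choose_le_pow n _
  refine le_trans (Finset.card_le_card_of_injOn (fun e => (e.1.erase v).erase u) ?_ ?_) h1
  · intro e he
    simp only [Finset.mem_coe, Finset.mem_filter, Finset.mem_univ, true_and] at he
    simp only [Finset.mem_coe, Finset.mem_powersetCard, Finset.subset_univ, true_and]
    rw [Finset.card_erase_of_mem (Finset.mem_erase.2 ⟨h, he.2⟩), Finset.card_erase_of_mem he.1, e.2]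
    omega
  · intro e he e' he' hee
    simp only [Finset.mem_coe, Finset.mem_filter, Finset.mem_univ, true_and] at he he'
    have h2 : ∀ a : Hyperedge n d, v ∈ a.1 ∧ u ∈ a.1 →
        insert v (insert u ((a.1.erase v).erase u)) = a.1 := fun a ha => by
      rw [Finset.insert_erase (Finset.mem_erase.2 ⟨h, ha.2⟩), Finset.insert_erase ha.1]
    refine Subtype.ext ?_
    rw [← h2 e he, ← h2 e' he']
    simp only at hee
    rw [hee]

theorem card_sharedEdges_le (hd : 2 ≤ d) (S : Finset (Fin n)) (v : Fin n) :
    (sharedEdges d S v).card ≤ S.card * n ^ (d - 2) := by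
  have h1 : sharedEdges d S v ⊆ (S.erase v).biUnion fun u =>
      Finset.univ.filter fun e => v ∈ e.1 ∧ u ∈ e.1 := by
    intro e he
    simp only [sharedEdges, Finset.mem_filter, Finset.mem_univ, true_and] at he
    obtain ⟨hv, u, hu, huv, hue⟩ := he
    simp only [Finset.mem_biUnion, Finset.mem_filter, Finset.mem_univ, true_and]
    exact ⟨u, Finset.mem_erase.2 ⟨huv, hu⟩, hv, hue⟩
  refine (Finset.card_le_card h1).trans ((Finset.card_biUnion_le_card_mul _ _ (n ^ (d - 2))
    fun u hu => card_filter_mem_mem_le hd (Finset.ne_of_mem_erase hu)).trans ?_)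
  exact Nat.mul_le_mul_right _ (Finset.card_erase_le)

/-- At most `|S| n ^ (d - 2)` hyperedges are shared, each of probability `O(log n / n ^ (d - 1))`;
the sum of all values of `Q` serves as a crude bound for their maximum. -/
theorem sum_edgeProb_sharedEdges_le {Q : (Fin k → ℕ) → ℝ}
    (hQ : ∀ T : Fin k → ℕ, ∑ i, T i = d → 0 ≤ Q T) (hd : 2 ≤ d) (S : Finset (Fin n))
    (z : Labeling n k) (v : Fin n) :
    ∑ e ∈ sharedEdges d S v, edgeProb Q z e ≤
      (∑ T ∈ Finset.piAntidiag Finset.univ d, Q T) * (S.card * Real.log n / n) := by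
  have hn : (0 : ℝ) < n := by exact_mod_cast v.pos
  have hq : ∀ e ∈ sharedEdges d S v, edgeProb Q z e ≤
      (∑ T ∈ Finset.piAntidiag Finset.univ d, Q T) * Real.log n / (n : ℝ) ^ (d - 1) := by
    intro e _
    refine (min_le_right _ _).trans ?_
    refine div_le_div_of_nonneg_right (mul_le_mul_of_nonneg_right ?_ (Real.log_natCast_nonneg n))
      (by positivity)
    refine Finset.single_le_sum (f := Q) (fun T hT => hQ T (Finset.mem_piAntidiag.1 hT).1) ?_
    simp [Finset.mem_piAntidiag, sum_assignment]
  have hQ0 : 0 ≤ ∑ T ∈ Finset.piAntidiag Finset.univ d, Q T :=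
    Finset.sum_nonneg fun T hT => hQ T (Finset.mem_piAntidiag.1 hT).1
  refine (Finset.sum_le_sum hq).trans ?_
  rw [Finset.sum_const, nsmul_eq_mul]
  have hc : ((sharedEdges d S v).card : ℝ) ≤ S.card * (n : ℝ) ^ (d - 2) := by
    exact_mod_cast card_sharedEdges_le hd S v
  refine (mul_le_mul_of_nonneg_right hc (div_nonneg (mul_nonneg hQ0
    (Real.log_natCast_nonneg n)) (by positivity))).trans (le_of_eq ?_)
  have : d - 1 = (d - 2) + 1 := by omega
  rw [this, pow_succ]
  field_simp

end Model


/-! ### The failure probability for a fixed number of nodes. -/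

section Recovery

variable {n k d : ℕ}

open Classical in
/-- The conditional probability, given the community vector and the hypergraph, of recovery up to
a permutation of the labels. -/
noncomputable def recoveryProb (φ : Estimator k d) (z : Labeling n k) (G : Hypergraph n d) : ℝ :=
  ∑ zhat : Labeling n k, if misclassification zhat z = 0 then (φ n G zhat).toReal else 0

theorem sum_toReal_pmf {α : Type*} [Fintype α] (μ : PMF α) : ∑ a, (μ a).toReal = 1 := by
  rw [← ENNReal.toReal_sum fun a _ => μ.apply_ne_top a, ← tsum_fintype (L := .unconditional α),
    μ.tsum_coe, ENNReal.toReal_one]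

theorem recoveryProb_nonneg (φ : Estimator k d) (z : Labeling n k) (G : Hypergraph n d) :
    0 ≤ recoveryProb φ z G :=
  Finset.sum_nonneg fun _ _ => by
    split_ifs
    · exact ENNReal.toReal_nonneg
    · exact le_rfl

theorem exists_perm_of_misclassification_eq_zero {zhat z : Labeling n k}
    (h : misclassification zhat z = 0) : ∃ π : Equiv.Perm (Fin k), ∀ v, zhat v = π (z v) := by
  obtain ⟨π, _, hπ⟩ := Finset.exists_mem_eq_inf' (s := Finset.univ) Finset.univ_nonempty
    fun π : Equiv.Perm (Fin k) => (1 / (n : ℝ)) * ∑ v, if zhat v ≠ π (z v) then (1 : ℝ) else 0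
  refine ⟨π, fun v => ?_⟩
  have hn : (n : ℝ) ≠ 0 := by exact_mod_cast v.pos.ne'
  rw [misclassification, hπ, mul_eq_zero, or_iff_right (one_div_ne_zero hn),
    Finset.sum_eq_zero_iff_of_nonneg fun u _ => by split_ifs <;> norm_num] at h
  by_contra hv
  simpa [hv] using h v (Finset.mem_univ v)

/-- Two labelings that are not relabellings of each other cannot both be recovered. -/
theorem recoveryProb_add_le_one (φ : Estimator k d) {z z' : Labeling n k}
    (h : ∀ π : Equiv.Perm (Fin k), ∃ v, z' v ≠ π (z v)) (G : Hypergraph n d) :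
    recoveryProb φ z G + recoveryProb φ z' G ≤ 1 := by
  rw [recoveryProb, recoveryProb, ← Finset.sum_add_distrib, ← sum_toReal_pmf (φ n G)]
  refine Finset.sum_le_sum fun zhat _ => ?_
  by_cases h1 : misclassification zhat z = 0
  · have h2 : misclassification zhat z' ≠ 0 := by
      intro h2
      obtain ⟨π, hπ⟩ := exists_perm_of_misclassification_eq_zero h1
      obtain ⟨π', hπ'⟩ := exists_perm_of_misclassification_eq_zero h2
      obtain ⟨v, hv⟩ := h (π'⁻¹ * π)
      refine hv ?_
      rw [Equiv.Perm.mul_apply, ← hπ, hπ']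
      exact (π'.symm_apply_apply _).symm
    simp [h1, h2]
  · rw [if_neg h1, zero_add]
    split_ifs
    · exact le_rfl
    · exact ENNReal.toReal_nonneg

theorem recoveryProb_le_one (φ : Estimator k d) (z : Labeling n k) (G : Hypergraph n d) :
    recoveryProb φ z G ≤ 1 := by
  rw [recoveryProb, ← sum_toReal_pmf (φ n G)]
  refine Finset.sum_le_sum fun zhat _ => ?_
  split_ifs
  · exact le_rfl
  · exact ENNReal.toReal_nonneg

/-- The other nodes labelled `i` and `j` force `π` to fix both labels, and then `π` contradicts the
exchange at `v`. -/
theorem relabel_ne_perm {i j : Fin k} (hij : i ≠ j) {v : Fin n} {z : Labeling n k}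
    (hv : z v = i ∨ z v = j) (hi : ∃ u, u ≠ v ∧ z u = i) (hj : ∃ u, u ≠ v ∧ z u = j)
    (π : Equiv.Perm (Fin k)) : ∃ u, relabel i j v z u ≠ π (z u) := by
  by_contra! h
  obtain ⟨u, hu, hui⟩ := hi
  obtain ⟨w, hw, hwj⟩ := hj
  have h1 := h u
  have h2 := h w
  have h3 := h v
  rw [relabel_of_ne hu, hui] at h1
  rw [relabel_of_ne hw, hwj] at h2
  rw [relabel_self] at h3
  rcases hv with hv | hv
  · rw [hv, Equiv.swap_apply_left, ← h1] at h3
    exact hij h3.symm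
  · rw [hv, Equiv.swap_apply_right, ← h2] at h3
    exact hij h3

theorem sum_failure (p : Fin k → ℝ) (Q : (Fin k → ℕ) → ℝ) (hp : ∑ i, p i = 1)
    (φ : Estimator k d) :
    ∑ x : Labeling n k × Hypergraph n d, jointProb p Q x.1 x.2 * (1 - recoveryProb φ x.1 x.2) =
      1 - successProb p Q φ n := by
  simp only [mul_sub, mul_one, Finset.sum_sub_distrib]
  congr 1
  · rw [Fintype.sum_prod_type, sum_jointProb Q hp]
  · rw [Fintype.sum_prod_type]
    rfl

/-- The weight of the pair `(z, G)` at a node `v`: it is nonzero when `v` has no shared hyperedge in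
`G` and its exclusive hyperedges in `G` have the profile `x`. -/
noncomputable def nodeWeight (Q : (Fin k → ℕ) → ℝ) (S : Finset (Fin n))
    (T : Finset (Labeling n k)) (x : (Fin k → ℕ) → ℕ) (i j : Fin k) (v : Fin n)
    (y : Labeling n k × Hypergraph n d) : ℝ :=
  if y.1 ∈ T ∧ (y.1 v = i ∨ y.1 v = j) then
    uniformDensity (edgeProb Q y.1) (exclusiveEdges d S v) (profileConfigs S y.1 v x)
      (y.2 ∩ exclusiveEdges d S v) * (if y.2 ∩ sharedEdges d S v = ∅ then 1 else 0)
  else 0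

/-- The probability that a node of community `i` has the profile `x` of exclusive hyperedges. -/
noncomputable def profileProb (Q : (Fin k → ℕ) → ℝ) (d : ℕ) (S : Finset (Fin n))
    (x : (Fin k → ℕ) → ℕ) (i : Fin k) (z : Labeling n k) : ℝ :=
  ∏ m ∈ neighborAssignments k d, ((typeCount S z m).choose (x m) *
    (typeProb Q d n i m ^ x m * (1 - typeProb Q d n i m) ^ (typeCount S z m - x m)))

theorem card_mul_bernWeight (Q : (Fin k → ℕ) → ℝ) {S : Finset (Fin n)} {v : Fin n} (hv : v ∈ S)
    (hd : 1 ≤ d) {x : (Fin k → ℕ) → ℕ} {z : Labeling n k} {H : Finset (Hyperedge n d)}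
    (hH : H ∈ profileConfigs S z v x) :
    ((profileConfigs (d := d) S z v x).card : ℝ) *
      bernWeight (edgeProb Q z) (exclusiveEdges d S v) H = profileProb Q d S x (z v) z := by
  rw [bernWeight_of_mem_profileConfigs Q hv hd hH, card_profileConfigs hv hd, profileProb,
    Nat.cast_prod, ← Finset.prod_mul_distrib]

theorem profileConfigs_nonempty {Q : (Fin k → ℕ) → ℝ} {S : Finset (Fin n)} {v : Fin n}
    (hv : v ∈ S) (hd : 1 ≤ d) {x : (Fin k → ℕ) → ℕ} {z : Labeling n k} {i : Fin k}
    (h : 0 < profileProb Q d S x i z) : (profileConfigs (d := d) S z v x).Nonempty := by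
  rw [← Finset.card_pos, card_profileConfigs hv hd, Nat.pos_iff_ne_zero, Finset.prod_ne_zero_iff]
  intro m hm h0
  refine h.ne' (Finset.prod_eq_zero hm ?_)
  simp [h0]

variable {p : Fin k → ℝ} {Q : (Fin k → ℕ) → ℝ} {S : Finset (Fin n)} {T : Finset (Labeling n k)}
  {x : (Fin k → ℕ) → ℕ} {i j : Fin k}

theorem sum_bernWeight_mul_profileDensity {v : Fin n} (hv : v ∈ S) (hd : 1 ≤ d)
    {z : Labeling n k} (hpos : 0 < profileProb Q d S x (z v) z) :
    ∑ H ∈ (exclusiveEdges d S v).powerset, bernWeight (edgeProb Q z) (exclusiveEdges d S v) H *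
      uniformDensity (edgeProb Q z) (exclusiveEdges d S v) (profileConfigs S z v x) H = 1 := by
  refine sum_bernWeight_mul_uniformDensity (Finset.filter_subset _ _)
    (profileConfigs_nonempty hv hd hpos) fun H hH h0 => ?_
  rw [← card_mul_bernWeight Q hv hd hH, h0, mul_zero] at hpos
  exact hpos.false

/-- The density of the exclusive part integrates to 1, independently of the shared part. -/
theorem sum_graphProb_mul_nodeWeight {v : Fin n} (hv : v ∈ S) (hd : 1 ≤ d) {z : Labeling n k}
    (hz : z ∈ T ∧ (z v = i ∨ z v = j)) (hpos : 0 < profileProb Q d S x (z v) z) :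
    ∑ G : Hypergraph n d, graphProb Q z G * nodeWeight Q S T x i j v (z, G) =
      bernWeight (edgeProb Q z) (sharedEdges d S v) ∅ := by
  have h := sum_bernWeight_mul (edgeProb Q z) (disjoint_exclusiveEdges_sharedEdges (d := d)
    (S := S) (v := v)) (uniformDensity (edgeProb Q z) (exclusiveEdges d S v)
    (profileConfigs S z v x)) (fun H => if H = ∅ then 1 else 0)
  rw [sum_bernWeight_mul_profileDensity hv hd hpos, one_mul] at h
  simp only [nodeWeight, if_pos hz, graphProb_eq_bernWeight]
  rw [h]
  simp

theorem nodeWeight_le (hQ : ∀ T : Fin k → ℕ, ∑ i, T i = d → 0 ≤ Q T) (v : Fin n)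
    (z : Labeling n k) (G : Hypergraph n d) :
    nodeWeight Q S T x i j v (z, G) ≤ uniformDensity (edgeProb Q z) (exclusiveEdges d S v)
      (profileConfigs S z v x) (G ∩ exclusiveEdges d S v) := by
  have h := uniformDensity_nonneg (edgeProb_nonneg hQ z) (edgeProb_le_one Q z)
    (exclusiveEdges d S v) (profileConfigs S z v x) (G ∩ exclusiveEdges d S v)
  unfold nodeWeight
  split_ifs
  · rw [mul_one]
  · rwa [mul_zero]
  · exact h

theorem nodeWeight_nonneg (hQ : ∀ T : Fin k → ℕ, ∑ i, T i = d → 0 ≤ Q T) (v : Fin n)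
    (y : Labeling n k × Hypergraph n d) : 0 ≤ nodeWeight Q S T x i j v y := by
  have h := uniformDensity_nonneg (edgeProb_nonneg hQ y.1) (edgeProb_le_one Q y.1)
    (exclusiveEdges d S v) (profileConfigs S y.1 v x) (y.2 ∩ exclusiveEdges d S v)
  unfold nodeWeight
  split_ifs
  · rwa [mul_one]
  · rw [mul_zero]
  · exact le_rfl

theorem graphProb_nonneg (hQ : ∀ T : Fin k → ℕ, ∑ i, T i = d → 0 ≤ Q T)
    (z : Labeling n k) (G : Hypergraph n d) : 0 ≤ graphProb Q z G :=
  bernWeight_nonneg (edgeProb_nonneg hQ z) (edgeProb_le_one Q z) _ _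

/-- The density cancels the probability of the exclusive hyperedges. Of the three remaining factors,
only that of the empty shared part can depend on which of the labels `i`, `j` the node `v` carries.
-/
theorem graphProb_mul_nodeWeight {v : Fin n} (hv : v ∈ S) (hd : 1 ≤ d) {z : Labeling n k}
    (hz : z ∈ T ∧ (z v = i ∨ z v = j)) (hpos : 0 < profileProb Q d S x (z v) z)
    (G : Hypergraph n d) :
    graphProb Q z G * nodeWeight Q S T x i j v (z, G) =
      if G ∩ exclusiveEdges d S v ∈ profileConfigs S z v x ∧ G ∩ sharedEdges d S v = ∅ then
        bernWeight (edgeProb Q z) (sharedEdges d S v) ∅ *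
          bernWeight (edgeProb Q z) (exclusiveEdges d S v ∪ sharedEdges d S v)ᶜ G *
            ((profileConfigs (d := d) S z v x).card : ℝ)⁻¹
      else 0 := by
  by_cases h1 : G ∩ exclusiveEdges d S v ∈ profileConfigs S z v x
  · by_cases h2 : G ∩ sharedEdges d S v = ∅
    · have h3 := card_mul_bernWeight Q hv hd h1
      have h4 : bernWeight (edgeProb Q z) (exclusiveEdges d S v) G ≠ 0 := by
        intro h0
        rw [bernWeight_inter, h0, mul_zero] at h3
        exact hpos.ne h3
      have h5 : bernWeight (edgeProb Q z) (sharedEdges d S v) G =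
          bernWeight (edgeProb Q z) (sharedEdges d S v) ∅ := by
        rw [← bernWeight_inter, h2]
      rw [if_pos ⟨h1, h2⟩, nodeWeight, if_pos hz, if_pos h2, uniformDensity, if_pos h1,
        graphProb_eq_bernWeight, ← Finset.union_compl (exclusiveEdges d S v ∪ sharedEdges d S v),
        bernWeight_union _ disjoint_compl_right,
        bernWeight_union _ disjoint_exclusiveEdges_sharedEdges, bernWeight_inter, h5, mul_inv]
      field_simp
    · simp [nodeWeight, h2]
  · simp [nodeWeight, uniformDensity, h1]

theorem bernWeight_relabel_compl {v : Fin n} (hv : v ∈ S) (z : Labeling n k)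
    (G : Hypergraph n d) :
    bernWeight (edgeProb Q (relabel i j v z)) (exclusiveEdges d S v ∪ sharedEdges d S v)ᶜ G =
      bernWeight (edgeProb Q z) (exclusiveEdges d S v ∪ sharedEdges d S v)ᶜ G := by
  refine Finset.prod_congr rfl fun e he => ?_
  rw [edgeProb_relabel]
  intro hve
  rw [Finset.mem_compl, Finset.mem_union] at he
  exact he (mem_exclusiveEdges_or_mem_sharedEdges hv hve)

/-- Only the factor at `v` changes; it is at most 1 before the exchange and at least `p i * p j`
after it. -/
theorem labelProb_le_relabel (hp0 : ∀ i, 0 < p i) (hp : ∑ i, p i = 1) {v : Fin n}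
    {z : Labeling n k} (hz : z v = i ∨ z v = j) :
    labelProb p z ≤ 1 / (p i * p j) * labelProb p (relabel i j v z) := by
  have hp1 : ∀ i, p i ≤ 1 := fun i =>
    hp ▸ Finset.single_le_sum (fun j _ => (hp0 j).le) (Finset.mem_univ i)
  have h1 : ∏ u ∈ Finset.univ.erase v, p (relabel i j v z u) =
      ∏ u ∈ Finset.univ.erase v, p (z u) :=
    Finset.prod_congr rfl fun u hu => by rw [relabel_of_ne (Finset.ne_of_mem_erase hu)]
  have h2 : 0 ≤ ∏ u ∈ Finset.univ.erase v, p (z u) := Finset.prod_nonneg fun u _ => (hp0 _).le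
  have h3 : p i * p j ≤ p (relabel i j v z v) := by
    rw [relabel_self]
    rcases hz with h | h <;> rw [h]
    · rw [Equiv.swap_apply_left]
      exact mul_le_of_le_one_left (hp0 j).le (hp1 i)
    · rw [Equiv.swap_apply_right]
      exact mul_le_of_le_one_right (hp0 i).le (hp1 j)
  rw [labelProb, labelProb, ← Finset.mul_prod_erase _ _ (Finset.mem_univ v),
    ← Finset.mul_prod_erase _ (fun u => p (relabel i j v z u)) (Finset.mem_univ v), h1,
    one_div, inv_mul_eq_div, le_div_iff₀ (mul_pos (hp0 i) (hp0 j))]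
  calc (p (z v) * ∏ u ∈ Finset.univ.erase v, p (z u)) * (p i * p j)
      = (p (z v) * (p i * p j)) * ∏ u ∈ Finset.univ.erase v, p (z u) := by ring
    _ ≤ p (relabel i j v z v) * ∏ u ∈ Finset.univ.erase v, p (z u) :=
        mul_le_mul_of_nonneg_right ((mul_le_of_le_one_left
          (mul_pos (hp0 i) (hp0 j)).le (hp1 _)).trans h3) h2

/-- A lower bound for the failure probability of every estimator on `n` nodes, when the profile `x`
of exclusive hyperedges has, for both communities, probability at least `1 / |S|`. -/
theorem sq_le_failure (hd : 2 ≤ d) (hp0 : ∀ i, 0 < p i) (hp : ∑ i, p i = 1)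
    (hQ : ∀ T : Fin k → ℕ, ∑ i, T i = d → 0 ≤ Q T) (hij : i ≠ j) (hS : S.Nonempty)
    (hTrel : ∀ v ∈ S, ∀ z ∈ T, relabel i j v z ∈ T)
    (hTi : ∀ z ∈ T, ∃ u ∉ S, z u = i) (hTj : ∀ z ∈ T, ∃ u ∉ S, z u = j)
    (hshared : ∀ v ∈ S, ∀ z, ∑ e ∈ sharedEdges d S v, edgeProb Q z e ≤ 1 / 2)
    (hx : ∀ z ∈ T, ∀ l, l = i ∨ l = j → 1 / (S.card : ℝ) ≤ profileProb Q d S x l z)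
    (hTp : ∀ v ∈ S, p i / 2 ≤ ∑ z ∈ T.filter fun z => z v = i, labelProb p z)
    (φ : Estimator k d) :
    (p i / 4) ^ 2 ≤ 2 * (1 + 2 / (p i * p j)) ^ 2 * (1 - successProb p Q φ n) := by
  have hd1 : 1 ≤ d := by omega
  have hs : (0 : ℝ) < S.card := by exact_mod_cast hS.card_pos
  have hpos : ∀ z ∈ T, ∀ l, l = i ∨ l = j → 0 < profileProb Q d S x l z := fun z hz l hl =>
    (one_div_pos.2 hs).trans_le (hx z hz l hl)
  have hlp : ∀ z : Labeling n k, 0 ≤ labelProb p z := labelProb_nonneg fun i => (hp0 i).le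
  have hhalf : ∀ v ∈ S, ∀ z : Labeling n k,
      1 / 2 ≤ bernWeight (edgeProb Q z) (sharedEdges d S v) ∅ := by
    intro v hv z
    have := one_sub_sum_le_bernWeight (edgeProb_nonneg hQ z) (edgeProb_le_one Q z)
      (sharedEdges d S v)
    linarith [hshared v hv z]
  have hone : ∀ v : Fin n, ∀ z : Labeling n k,
      bernWeight (edgeProb Q z) (sharedEdges d S v) ∅ ≤ 1 := fun v z =>
    bernWeight_le_one (edgeProb_nonneg hQ z) (edgeProb_le_one Q z) _ _
  have hcond : ∀ v ∈ S, ∀ z : Labeling n k,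
      ∑ G : Hypergraph n d, graphProb Q z G * nodeWeight Q S T x i j v (z, G) =
        if z ∈ T ∧ (z v = i ∨ z v = j) then
          bernWeight (edgeProb Q z) (sharedEdges d S v) ∅ else 0 := by
    intro v hv z
    split_ifs with h
    · exact sum_graphProb_mul_nodeWeight hv hd1 h (hpos z h.1 _ h.2)
    · simp [nodeWeight, h]
  have hmean : ∀ v ∈ S, ∑ y : Labeling n k × Hypergraph n d,
      jointProb p Q y.1 y.2 * nodeWeight Q S T x i j v y = ∑ z, labelProb p z *
        if z ∈ T ∧ (z v = i ∨ z v = j) then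
          bernWeight (edgeProb Q z) (sharedEdges d S v) ∅ else 0 := by
    intro v hv
    rw [Fintype.sum_prod_type]
    refine Finset.sum_congr rfl fun z _ => ?_
    rw [← hcond v hv z, Finset.mul_sum]
    exact Finset.sum_congr rfl fun G _ => by rw [jointProb, mul_assoc]
  rw [← sum_failure p Q hp φ]
  refine sq_le_sum_of_paired (w := fun v y => nodeWeight Q S T x i j v y)
    (σ := fun v y => (relabel i j v y.1, y.2)) hS ?_ ?_ ?_ ?_ ?_ ?_ ?_ ?_ ?_ ?_ ?_ ?_ ?_
  · intro v y
    simp only [relabel_involutive i j v y.1]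
  · exact fun y => jointProb_nonneg (fun i => (hp0 i).le) hQ y.1 y.2
  · exact fun y => sub_nonneg.2 (recoveryProb_le_one φ y.1 y.2)
  · exact fun y => sub_le_self _ (recoveryProb_nonneg φ y.1 y.2)
  · exact fun v y => nodeWeight_nonneg hQ v y
  · exact div_nonneg (hp0 i).le (by norm_num)
  · exact div_nonneg (by norm_num) (mul_pos (hp0 i) (hp0 j)).le
  · rintro v hv ⟨z, G⟩ hne
    have hz : z ∈ T ∧ (z v = i ∨ z v = j) := by
      by_contra h
      exact hne (by simp [nodeWeight, h])
    obtain ⟨u, hu, hui⟩ := hTi z hz.1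
    obtain ⟨u', hu', huj⟩ := hTj z hz.1
    have := recoveryProb_add_le_one φ (relabel_ne_perm hij hz.2
      ⟨u, fun h => hu (h ▸ hv), hui⟩ ⟨u', fun h => hu' (h ▸ hv), huj⟩) G
    simp only
    linarith
  · rintro v hv ⟨z, G⟩
    simp only
    by_cases hz : z ∈ T ∧ (z v = i ∨ z v = j)
    · have hz' : relabel i j v z ∈ T ∧ (relabel i j v z v = i ∨ relabel i j v z v = j) := by
        refine ⟨hTrel v hv z hz.1, ?_⟩
        rw [relabel_self]
        rcases hz.2 with h | h <;> simp [h]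
      -- The labels contribute `1 / (p i * p j)`. The factor 2 compares two probabilities of an
      -- empty shared part, both in `[1/2, 1]`.
      have hC : 2 / (p i * p j) = 1 / (p i * p j) * 2 := by ring
      rw [jointProb, jointProb, mul_assoc, mul_assoc, hC]
      refine (mul_le_mul (labelProb_le_relabel hp0 hp hz.2) (?_ : _ ≤ 2 *
        (graphProb Q (relabel i j v z) G * nodeWeight Q S T x i j v (relabel i j v z, G)))
        (mul_nonneg (graphProb_nonneg hQ z G) (nodeWeight_nonneg hQ v _)) ?_).trans
        (le_of_eq (by ring))
      · rw [graphProb_mul_nodeWeight hv hd1 hz (hpos z hz.1 _ hz.2),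
          graphProb_mul_nodeWeight hv hd1 hz' (hpos _ hz'.1 _ hz'.2), profileConfigs_relabel,
          bernWeight_relabel_compl hv]
        split_ifs
        · have h1 := hone v z
          have h2 := hhalf v hv (relabel i j v z)
          have h3 : 0 ≤ bernWeight (edgeProb Q z)
              (exclusiveEdges d S v ∪ sharedEdges d S v)ᶜ G *
                ((profileConfigs (d := d) S z v x).card : ℝ)⁻¹ :=
            mul_nonneg (bernWeight_nonneg (edgeProb_nonneg hQ z) (edgeProb_le_one Q z) _ _)
              (by positivity)
          nlinarith
        · simp
      · exact mul_nonneg (by have := hp0 i; have := hp0 j; positivity) (hlp _)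
    · have : nodeWeight Q S T x i j v (z, G) = 0 := by simp [nodeWeight, hz]
      rw [this, mul_zero]
      exact mul_nonneg (by have := hp0 i; have := hp0 j; positivity)
        (mul_nonneg (jointProb_nonneg (fun i => (hp0 i).le) hQ _ _) (nodeWeight_nonneg hQ v _))
  · intro v hv
    rw [hmean v hv]
    calc p i / 4 = (p i / 2) * (1 / 2) := by ring
      _ ≤ (∑ z ∈ T.filter fun z => z v = i, labelProb p z) * (1 / 2) :=
          mul_le_mul_of_nonneg_right (hTp v hv) (by norm_num)
      _ = ∑ z ∈ T.filter fun z => z v = i, labelProb p z * (1 / 2) := Finset.sum_mul _ _ _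
      _ ≤ ∑ z ∈ T.filter fun z => z v = i, labelProb p z *
          (if z ∈ T ∧ (z v = i ∨ z v = j) then
            bernWeight (edgeProb Q z) (sharedEdges d S v) ∅ else 0) := by
          refine Finset.sum_le_sum fun z hz => mul_le_mul_of_nonneg_left ?_ (hlp z)
          rw [Finset.mem_filter] at hz
          rw [if_pos ⟨hz.1, Or.inl hz.2⟩]
          exact hhalf v hv z
      _ ≤ _ := by
          refine Finset.sum_le_sum_of_subset_of_nonneg (Finset.subset_univ _) fun z _ _ => ?_
          refine mul_nonneg (hlp z) ?_
          split_ifs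
          · linarith [hhalf v hv z]
          · exact le_rfl
  · intro v hv
    rw [hmean v hv, ← sum_labelProb (n := n) hp]
    refine Finset.sum_le_sum fun z _ => mul_le_of_le_one_right (hlp z) ?_
    split_ifs
    · exact hone v z
    · exact zero_le_one
  -- A nonzero density is the inverse of the profile probability, hence at most `|S|`.
  · rintro v hv ⟨z, G⟩
    by_cases hz : z ∈ T ∧ (z v = i ∨ z v = j)
    · refine (nodeWeight_le hQ v z G).trans ?_
      unfold uniformDensity
      split_ifs with h
      · rw [card_mul_bernWeight Q hv hd1 h]
        exact inv_le_of_inv_le₀ hs (by simpa using hx z hz.1 _ hz.2)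
      · exact hs.le
    · simp [nodeWeight, hz]
  -- Dropping the conditions on shared hyperedges leaves densities on disjoint sets of hyperedges,
  -- which are independent given the labels and have mean 1.
  · intro v hv u hu hvu
    rw [Fintype.sum_prod_type, ← sum_labelProb (n := n) hp]
    refine Finset.sum_le_sum fun z _ => ?_
    by_cases hz : z ∈ T ∧ (z v = i ∨ z v = j) ∧ (z u = i ∨ z u = j)
    · have h := sum_bernWeight_mul (edgeProb Q z) (disjoint_exclusiveEdges (d := d) (S := S) hvu)
        (uniformDensity (edgeProb Q z) (exclusiveEdges d S v) (profileConfigs S z v x))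
        (uniformDensity (edgeProb Q z) (exclusiveEdges d S u) (profileConfigs S z u x))
      rw [sum_bernWeight_mul_profileDensity hv hd1 (hpos z hz.1 _ hz.2.1),
        sum_bernWeight_mul_profileDensity hu hd1 (hpos z hz.1 _ hz.2.2), one_mul] at h
      rw [← mul_one (labelProb p z), ← h, Finset.mul_sum]
      refine Finset.sum_le_sum fun G _ => ?_
      rw [jointProb, mul_assoc, graphProb_eq_bernWeight]
      refine mul_le_mul_of_nonneg_left (mul_le_mul_of_nonneg_left ?_ (graphProb_nonneg hQ z G))
        (hlp z)
      exact mul_le_mul (nodeWeight_le hQ v z G) (nodeWeight_le hQ u z G)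
        (nodeWeight_nonneg hQ u _)
        (uniformDensity_nonneg (edgeProb_nonneg hQ z) (edgeProb_le_one Q z) _ _ _)
    · have : ∀ G : Hypergraph n d,
          nodeWeight Q S T x i j v (z, G) * nodeWeight Q S T x i j u (z, G) = 0 := by
        intro G
        by_cases h1 : z ∈ T ∧ (z v = i ∨ z v = j)
        · have h2 : ¬ (z ∈ T ∧ (z u = i ∨ z u = j)) := fun h2 => hz ⟨h1.1, h1.2, h2.2⟩
          simp [nodeWeight, h2]
        · simp [nodeWeight, h1]
      simp only [this, mul_zero, Finset.sum_const_zero]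
      exact hlp z

end Recovery


/-! ### Asymptotics along typical community vectors. -/

section Asymptotics

variable {k d : ℕ}

theorem sum_addNode {m : Fin k → ℕ} (hd : 1 ≤ d) (hm : m ∈ neighborAssignments k d) (i : Fin k) :
    ∑ s, addNode m i s = d := by
  have h := (Finset.mem_piAntidiag.1 hm).1
  simp only [addNode, Pi.add_apply, Finset.sum_add_distrib, Finset.sum_pi_single', Finset.mem_univ,
    if_true, h]
  omega

theorem normalizedCount_pos {p : Fin k → ℝ} (hp : ∀ i, 0 < p i) (m : Fin k → ℕ) :
    0 < normalizedCount p m :=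
  Finset.prod_pos fun s _ => div_pos (pow_pos (hp s) _) (by positivity)

theorem degreeProfile_nonneg {p : Fin k → ℝ} (hp : ∀ i, 0 < p i) {Q : (Fin k → ℕ) → ℝ}
    (hQ : ∀ T : Fin k → ℕ, ∑ i, T i = d → 0 ≤ Q T) (hd : 1 ≤ d) (i : Fin k) {m : Fin k → ℕ}
    (hm : m ∈ neighborAssignments k d) : 0 ≤ degreeProfile p Q i m :=
  mul_nonneg (normalizedCount_pos hp m).le (hQ _ (sum_addNode hd hm i))

theorem sum_le_gchDivergence {p : Fin k → ℝ} (hp : ∀ i, 0 < p i) {Q : (Fin k → ℕ) → ℝ}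
    (hQ : ∀ T : Fin k → ℕ, ∑ i, T i = d → 0 ≤ Q T) (hd : 1 ≤ d) (i j : Fin k) {t : ℝ}
    (ht : t ∈ Set.Icc (0 : ℝ) 1) :
    ∑ m ∈ neighborAssignments k d, (t * degreeProfile p Q i m + (1 - t) * degreeProfile p Q j m
      - degreeProfile p Q i m ^ t * degreeProfile p Q j m ^ (1 - t)) ≤ gchDivergence d p Q i j := by
  refine le_ciSup (f := fun t : Set.Icc (0 : ℝ) 1 => ∑ m ∈ neighborAssignments k d,
    ((t : ℝ) * degreeProfile p Q i m + (1 - (t : ℝ)) * degreeProfile p Q j m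
      - degreeProfile p Q i m ^ (t : ℝ) * degreeProfile p Q j m ^ (1 - (t : ℝ)))) ?_ ⟨t, ht⟩
  refine ⟨∑ m ∈ neighborAssignments k d, (degreeProfile p Q i m + degreeProfile p Q j m), ?_⟩
  rintro _ ⟨⟨t, ht⟩, rfl⟩
  refine Finset.sum_le_sum fun m hm => ?_
  have h1 := degreeProfile_nonneg hp hQ hd i hm
  have h2 := degreeProfile_nonneg hp hQ hd j hm
  have h3 := mul_nonneg (Real.rpow_nonneg h1 t) (Real.rpow_nonneg h2 (1 - t))
  simp only
  nlinarith [ht.1, ht.2, mul_nonneg (sub_nonneg.2 ht.2) h1, mul_nonneg ht.1 h2]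

theorem tendsto_choose_div_pow {ι : Type*} {l : Filter ι} {c : ι → ℕ} {x : ι → ℝ} {a : ℝ}
    (ha : 0 < a) (hx : Tendsto x l atTop) (hc : Tendsto (fun i => c i / x i) l (𝓝 a)) (m : ℕ) :
    Tendsto (fun i => ((c i).choose m : ℝ) / x i ^ m) l (𝓝 (a ^ m / m.factorial)) := by
  have hctop : Tendsto c l atTop := by
    refine tendsto_natCast_atTop_iff.1 ((hc.pos_mul_atTop ha hx).congr' ?_)
    filter_upwards [hx.eventually_gt_atTop 0] with i hi using div_mul_cancel₀ _ hi.ne'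
  have h := ((isEquivalent_choose m).comp_tendsto hctop).div
    (Asymptotics.IsEquivalent.refl (u := fun i => x i ^ m))
  refine h.symm.tendsto_nhds ?_
  refine ((hc.pow m).div_const _).congr fun i => ?_
  simp only [Pi.div_apply, Function.comp]
  rw [div_pow]
  ring

/-- The size `⌊n / log² n⌋` of the set of nodes in which a confusable node is sought. -/
noncomputable def sparseSize (n : ℕ) : ℕ := ⌊(n : ℝ) / Real.log n ^ 2⌋₊

/-- The first `sparseSize n` nodes. -/
noncomputable def sparseSet (n : ℕ) : Finset (Fin n) :=
  Finset.univ.filter fun v => (v : ℕ) < sparseSize n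

theorem tendsto_log_natCast : Tendsto (fun n : ℕ => Real.log n) atTop atTop :=
  Real.tendsto_log_atTop.comp tendsto_natCast_atTop_atTop

theorem sparseSize_le (n : ℕ) : (sparseSize n : ℝ) ≤ n / Real.log n ^ 2 :=
  Nat.floor_le (by positivity)

theorem eventually_card_sparseSet : ∀ᶠ n : ℕ in atTop, (sparseSet n).card = sparseSize n := by
  filter_upwards [tendsto_log_natCast.eventually_ge_atTop 1] with n hn
  rw [sparseSet, Fin.card_filter_val_lt, min_eq_right]
  have h : (sparseSize n : ℝ) ≤ n :=
    (sparseSize_le n).trans (div_le_self (Nat.cast_nonneg n) (one_le_pow₀ hn))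
  exact_mod_cast h

/-- The community vectors whose community sizes outside the sparse set are typical. -/
noncomputable def typicalSet (p : Fin k → ℝ) (n : ℕ) : Finset (Labeling n k) :=
  typicalLabelings p (sparseSet n)ᶜ (n / Real.log n)

/-- Large numbers of nodes, uniformly over the typical community vectors. -/
noncomputable def typicalFilter (p : Fin k → ℝ) : Filter (Σ n : ℕ, Labeling n k) :=
  comap Sigma.fst atTop ⊓ 𝓟 {y | y.2 ∈ typicalSet p y.1}

/-- Limits along this filter are limits in `n` uniform over typical `z`, so the usual calculus of
limits handles the uniformity. -/
theorem eventually_typicalFilter {p : Fin k → ℝ} {P : (Σ n : ℕ, Labeling n k) → Prop} :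
    (∀ᶠ y in typicalFilter p, P y) ↔ ∀ᶠ n in atTop, ∀ z ∈ typicalSet p n, P ⟨n, z⟩ := by
  rw [typicalFilter, eventually_inf_principal, eventually_comap]
  refine eventually_congr (Eventually.of_forall fun n => ?_)
  constructor
  · intro h z hz
    exact h ⟨n, z⟩ rfl hz
  · rintro h ⟨n', z⟩ rfl hz
    exact h z hz

theorem tendsto_fst_typicalFilter (p : Fin k → ℝ) :
    Tendsto (fun y : Σ n : ℕ, Labeling n k => y.1) (typicalFilter p) atTop :=
  tendsto_comap.mono_left inf_le_left

/-- Two errors are negligible relative to `n`: the typicality window `n / log n`, and the at most `n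
/ log² n` nodes removed with `S`. -/
theorem tendsto_count_div {p : Fin k → ℝ} (s : Fin k) :
    Tendsto (fun y : Σ n : ℕ, Labeling n k =>
      (((sparseSet y.1)ᶜ.filter fun u => y.2 u = s).card : ℝ) / (y.1 : ℝ))
      (typicalFilter p) (𝓝 (p s)) := by
  have hlim : Tendsto (fun n : ℕ => 1 / Real.log n + |p s| * (1 / Real.log n ^ 2)) atTop (𝓝 0) := by
    have h1 := tendsto_log_natCast.const_div_atTop 1
    have h2 := (((tendsto_pow_atTop two_ne_zero).comp tendsto_log_natCast).const_div_atTop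
      1).const_mul |p s|
    simpa using h1.add h2
  rw [tendsto_iff_dist_tendsto_zero]
  refine squeeze_zero' (Eventually.of_forall fun _ => dist_nonneg) ?_
    (hlim.comp (tendsto_fst_typicalFilter p))
  rw [eventually_typicalFilter]
  filter_upwards [eventually_card_sparseSet, eventually_gt_atTop 0,
    tendsto_log_natCast.eventually_gt_atTop 0] with n hcard hn hlog z hz
  have hn' : (0 : ℝ) < n := by exact_mod_cast hn
  simp only [typicalSet, typicalLabelings, Finset.mem_filter, Finset.mem_univ, true_and] at hz
  have h1 := hz s
  have h2 : ((sparseSet n)ᶜ.card : ℝ) = n - sparseSize n := by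
    rw [Finset.card_compl, Fintype.card_fin, Nat.cast_sub, hcard]
    exact (Finset.card_le_univ _).trans_eq (Fintype.card_fin n)
  rw [h2] at h1
  set c : ℝ := (((sparseSet n)ᶜ.filter fun u => z u = s).card : ℝ)
  simp only [Function.comp]
  rw [Real.dist_eq]
  have h3 : c / n - p s = ((c - (n - sparseSize n) * p s) - sparseSize n * p s) / n := by
    field_simp
    ring
  rw [h3, abs_div, abs_of_pos hn', div_le_iff₀ hn']
  have h4 : |(sparseSize n : ℝ) * p s| ≤ n / Real.log n ^ 2 * |p s| := by
    rw [abs_mul, Nat.abs_cast]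
    exact mul_le_mul_of_nonneg_right (sparseSize_le n) (abs_nonneg _)
  refine (abs_sub _ _).trans ((add_le_add h1 h4).trans (le_of_eq ?_))
  ring

theorem tendsto_typeCount_div {p : Fin k → ℝ} (hp : ∀ i, 0 < p i) {m : Fin k → ℕ}
    (hm : m ∈ neighborAssignments k d) :
    Tendsto (fun y : Σ n : ℕ, Labeling n k =>
      (typeCount (sparseSet y.1) y.2 m : ℝ) / (y.1 : ℝ) ^ (d - 1))
      (typicalFilter p) (𝓝 (normalizedCount p m)) := by
  have h := tendsto_finsetProd (Finset.univ : Finset (Fin k)) fun s _ =>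
    tendsto_choose_div_pow (hp s) (tendsto_natCast_atTop_atTop.comp (tendsto_fst_typicalFilter p))
      (tendsto_count_div (p := p) s) (m s)
  refine h.congr fun y => ?_
  simp only [typeCount, Finset.prod_div_distrib, Function.comp, Nat.cast_prod,
    Finset.prod_pow_eq_pow_sum, (Finset.mem_piAntidiag.1 hm).1]

theorem tendsto_log_div_pow (hd : 2 ≤ d) (a : ℝ) :
    Tendsto (fun n : ℕ => a * Real.log n / (n : ℝ) ^ (d - 1)) atTop (𝓝 0) := by
  have h1 : Tendsto (fun x : ℝ => Real.log x / x) atTop (𝓝 0) :=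
    Real.isLittleO_log_id_atTop.tendsto_div_nhds_zero
  have h2 : Tendsto (fun n : ℕ => |a| * (Real.log n / n)) atTop (𝓝 0) := by
    simpa using (h1.comp tendsto_natCast_atTop_atTop).const_mul |a|
  refine squeeze_zero_norm' ?_ h2
  filter_upwards [eventually_ge_atTop 1] with n hn
  have hn' : (1 : ℝ) ≤ n := by exact_mod_cast hn
  rw [norm_div, norm_mul, Real.norm_eq_abs, Real.norm_of_nonneg (Real.log_natCast_nonneg n),
    Real.norm_of_nonneg (by positivity), ← mul_div_assoc]
  refine div_le_div_of_nonneg_left (mul_nonneg (abs_nonneg _) (Real.log_natCast_nonneg n))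
    (by positivity) ?_
  exact le_self_pow₀ hn' (by omega)

/-- The types contribute independent binomial counts, so their exponents add up; the truncation at 1
and the rounding disappear in the limit. -/
theorem eventually_exp_le_profileProb {p : Fin k → ℝ} (hp : ∀ i, 0 < p i)
    {Q : (Fin k → ℕ) → ℝ} (hQ : ∀ T : Fin k → ℕ, ∑ i, T i = d → 0 ≤ Q T) (hd : 2 ≤ d) (i : Fin k)
    {τ : (Fin k → ℕ) → ℝ} (hτ : ∀ m, 0 ≤ τ m)
    (hpos : ∀ m ∈ neighborAssignments k d, 0 < τ m → 0 < degreeProfile p Q i m) {ρ : ℝ}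
    (hρ : ∑ m ∈ neighborAssignments k d, poissonDivergence (τ m) (degreeProfile p Q i m) < ρ) :
    ∀ᶠ n in atTop, ∀ z ∈ typicalSet p n, Real.exp (-(ρ * Real.log n)) ≤
      profileProb Q d (sparseSet n) (fun m => ⌊τ m * Real.log n⌋₊) i z := by
  set M := neighborAssignments k d with hM
  set D := ∑ m ∈ M, poissonDivergence (τ m) (degreeProfile p Q i m) with hD
  -- The slack `ρ - D` is divided among the types; the added 1 keeps the denominator positive.
  set η : ℝ := (ρ - D) / (M.card + 1) with hη
  have hη0 : 0 < η := div_pos (by linarith) (by positivity)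
  have hηM : D + M.card * η ≤ ρ := by
    have : η * (M.card + 1) = ρ - D := div_mul_cancel₀ _ (by positivity)
    linarith
  have hfst := tendsto_fst_typicalFilter p
  have hlog := tendsto_log_natCast.comp hfst
  have key : ∀ m ∈ M, ∀ᶠ y in typicalFilter p,
      Real.exp (-(Real.log y.1 * (poissonDivergence (τ m) (degreeProfile p Q i m) + η))) ≤
        (typeCount (sparseSet y.1) y.2 m).choose ⌊τ m * Real.log y.1⌋₊ *
          (typeProb Q d y.1 i m ^ ⌊τ m * Real.log y.1⌋₊ * (1 - typeProb Q d y.1 i m) ^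
            (typeCount (sparseSet y.1) y.2 m - ⌊τ m * Real.log y.1⌋₊)) := by
    intro m hm
    have hQm : 0 ≤ Q (addNode m i) := hQ _ (sum_addNode (by omega) hm i)
    have hlim := tendsto_log_div_pow hd (Q (addNode m i))
    have heq : ∀ᶠ n : ℕ in atTop, typeProb Q d n i m =
        Q (addNode m i) * Real.log n / (n : ℝ) ^ (d - 1) := by
      filter_upwards [hlim.eventually_lt_const one_pos] with n hn
      exact min_eq_right hn.le
    refine eventually_exp_le_binomial (L := fun y : Σ n : ℕ, Labeling n k => Real.log y.1)
      (q := fun y => typeProb Q d y.1 i m) (N := fun y => typeCount (sparseSet y.1) y.2 m)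
      hlog (hτ m) (hpos m hm) ?_ ?_ ?_ hη0
    · refine Eventually.of_forall fun y => le_min zero_le_one ?_
      exact div_nonneg (mul_nonneg hQm (Real.log_natCast_nonneg _)) (by positivity)
    · exact (hlim.congr' (heq.mono fun n hn => hn.symm)).comp hfst
    · refine ((tendsto_typeCount_div hp hm).mul_const (Q (addNode m i))).congr' ?_
      filter_upwards [hfst.eventually heq, hlog.eventually_gt_atTop 0] with y hy hy0
      simp only [Function.comp] at hy0
      rw [hy]
      field_simp
  have key' := (Filter.eventually_all_finset M).2 key
  rw [eventually_typicalFilter] at key'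
  filter_upwards [key'] with n hn z hz
  refine le_trans ?_ (Finset.prod_le_prod (fun m _ => (Real.exp_pos _).le) fun m hm => hn z hz m hm)
  rw [← Real.exp_sum, Finset.sum_neg_distrib, ← Finset.mul_sum, Finset.sum_add_distrib,
    Finset.sum_const, nsmul_eq_mul, mul_comm ρ]
  refine Real.exp_le_exp.2 (neg_le_neg (mul_le_mul_of_nonneg_left hηM (Real.log_natCast_nonneg n)))

theorem eventually_exp_le_sparseSize {ρ : ℝ} (hρ0 : 0 ≤ ρ) (hρ1 : ρ < 1) :
    ∀ᶠ n : ℕ in atTop, Real.exp (ρ * Real.log n) ≤ sparseSize n := by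
  have h := (isLittleO_pow_exp_pos_mul_atTop 2 (sub_pos.2 hρ1)).def (c := 1 / 2) (by norm_num)
  filter_upwards [tendsto_log_natCast.eventually h, tendsto_log_natCast.eventually_gt_atTop 0,
    eventually_gt_atTop 0] with n hn hlog hn0
  have hn0' : (0 : ℝ) < n := by exact_mod_cast hn0
  rw [Real.norm_of_nonneg (by positivity), Real.norm_of_nonneg (Real.exp_pos _).le] at hn
  set L := Real.log n
  have h1 : 1 ≤ Real.exp (ρ * L) := Real.one_le_exp (mul_nonneg hρ0 hlog.le)
  have h2 : (n : ℝ) = Real.exp (ρ * L) * Real.exp ((1 - ρ) * L) := by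
    rw [← Real.exp_add, ← Real.exp_log hn0']
    congr 1
    ring
  -- The factor 2 leaves room for the loss of at most 1 in the floor.
  have h3 : 2 * Real.exp (ρ * L) ≤ n / L ^ 2 := by
    rw [le_div_iff₀ (by positivity), h2]
    nlinarith
  have h4 := Nat.lt_floor_add_one ((n : ℝ) / L ^ 2)
  change _ ≤ ((⌊(n : ℝ) / L ^ 2⌋₊ : ℕ) : ℝ)
  linarith

/-- With `|S| ≤ n / log² n`, the expected number of shared hyperedges at a node is `O(1 / log n)`.
-/
theorem eventually_sum_sharedEdges_le {Q : (Fin k → ℕ) → ℝ}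
    (hQ : ∀ T : Fin k → ℕ, ∑ i, T i = d → 0 ≤ Q T) (hd : 2 ≤ d) :
    ∀ᶠ n : ℕ in atTop, ∀ (v : Fin n) (z : Labeling n k),
      ∑ e ∈ sharedEdges d (sparseSet n) v, edgeProb Q z e ≤ 1 / 2 := by
  have hQ0 : 0 ≤ ∑ T ∈ Finset.piAntidiag (Finset.univ : Finset (Fin k)) d, Q T :=
    Finset.sum_nonneg fun T hT => hQ T (Finset.mem_piAntidiag.1 hT).1
  have hlim := tendsto_log_natCast.const_div_atTop
    (∑ T ∈ Finset.piAntidiag (Finset.univ : Finset (Fin k)) d, Q T)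
  filter_upwards [eventually_card_sparseSet, hlim.eventually_lt_const (u := 1 / 2) (by norm_num),
    tendsto_log_natCast.eventually_gt_atTop 0, eventually_gt_atTop 0] with n hcard hn hlog hn0 v z
  have hn0' : (0 : ℝ) < n := by exact_mod_cast hn0
  refine (sum_edgeProb_sharedEdges_le hQ hd _ z v).trans (le_trans ?_ hn.le)
  rw [div_eq_mul_one_div (∑ T ∈ Finset.piAntidiag (Finset.univ : Finset (Fin k)) d, Q T), hcard]
  refine mul_le_mul_of_nonneg_left ?_ hQ0
  calc (sparseSize n : ℝ) * Real.log n / n ≤ n / Real.log n ^ 2 * Real.log n / n := by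
        gcongr
        exact sparseSize_le n
    _ = 1 / Real.log n := by field_simp

/-- With the window `n / log n`, Chebyshev's bound is `k log² n / n`, which tends to 0. -/
theorem eventually_half_le_typicalSet {p : Fin k → ℝ} (hp0 : ∀ i, 0 < p i) (hp : ∑ i, p i = 1)
    (i : Fin k) :
    ∀ᶠ n : ℕ in atTop, ∀ v : Fin n,
      p i / 2 ≤ ∑ z ∈ (typicalSet p n).filter fun z => z v = i, labelProb p z := by
  have h1 : Tendsto (fun x : ℝ => k * (Real.log x ^ 2 / x)) atTop (𝓝 0) := by
    simpa using ((Real.isLittleO_pow_log_id_atTop (n := 2)).tendsto_div_nhds_zero).const_mul (k : ℝ)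
  filter_upwards [(h1.comp tendsto_natCast_atTop_atTop).eventually_lt_const
    (half_pos (hp0 i)), tendsto_log_natCast.eventually_gt_atTop 0, eventually_gt_atTop 0]
    with n hn hlog hn0 v
  have hn0' : (0 : ℝ) < n := by exact_mod_cast hn0
  refine le_trans ?_ (le_sum_typicalLabelings (fun i => (hp0 i).le) hp _ (div_pos hn0' hlog) v i)
  have h2 : k * (n : ℝ) / (n / Real.log n) ^ 2 = k * (Real.log n ^ 2 / n) := by
    field_simp
  simp only [Function.comp] at hn
  rw [h2]
  linarith

theorem eventually_exists_label {p : Fin k → ℝ} (hp : ∀ i, 0 < p i) (i : Fin k) :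
    ∀ᶠ n : ℕ in atTop, ∀ z ∈ typicalSet p n, ∃ u ∉ sparseSet n, z u = i := by
  have h := (tendsto_count_div (p := p) i).eventually_const_lt (hp i)
  rw [eventually_typicalFilter] at h
  filter_upwards [h] with n hn z hz
  have h1 : ((sparseSet n)ᶜ.filter fun u => z u = i).card ≠ 0 := by
    intro h0
    have := hn z hz
    simp [h0] at this
  obtain ⟨u, hu⟩ := Finset.card_ne_zero.1 h1
  rw [Finset.mem_filter, Finset.mem_compl] at hu
  exact ⟨u, hu.1, hu.2⟩

end Asymptotics

end HSBM

/-! ### The converse. -/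

theorem theorem1 (k d : ℕ) (hk : 2 ≤ k) (hd : 2 ≤ d)
    (p : Fin k → ℝ) (hp_pos : ∀ i, 0 < p i) (hp_sum : ∑ i, p i = 1)
    (Q : (Fin k → ℕ) → ℝ) (hQ : ∀ T : Fin k → ℕ, ∑ i, T i = d → 0 ≤ Q T)
    (hD : (⨅ x : {x : Fin k × Fin k // x.1 ≠ x.2},
      HSBM.gchDivergence d p Q x.1.1 x.1.2) < 1) :
    ¬ ∃ φ : HSBM.Estimator k d, HSBM.AchievesExactRecovery p Q φ := by
  open HSBM in
  rintro ⟨φ, hφ⟩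
  have : Nonempty {x : Fin k × Fin k // x.1 ≠ x.2} :=
    ⟨⟨(⟨0, by omega⟩, ⟨1, by omega⟩), by simp⟩⟩
  obtain ⟨⟨⟨i, j⟩, hij⟩, hlt⟩ := exists_lt_of_ciInf_lt hD
  simp only at hij hlt
  have hd1 : 1 ≤ d := by omega
  obtain ⟨τ, hτ, hτpos, hτi, hτj⟩ := exists_balanced_profile (neighborAssignments k d)
    (degreeProfile p Q i) (degreeProfile p Q j)
    (fun m hm => degreeProfile_nonneg hp_pos hQ hd1 i hm)
    (fun m hm => degreeProfile_nonneg hp_pos hQ hd1 j hm)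
    (fun t ht => sum_le_gchDivergence hp_pos hQ hd1 i j (Set.Ioo_subset_Icc_self ht))
  -- Above the divergence, `ρ` gives the profile probability `n ^ (-ρ)`; below 1, it gives `n ^ ρ ≤
  -- |S|`.
  obtain ⟨ρ, hρ, hρ1⟩ := exists_between (max_lt hlt one_pos)
  obtain ⟨hDρ, hρ0⟩ := max_lt_iff.1 hρ
  have hev : ∀ᶠ n in atTop,
      (p i / 4) ^ 2 ≤ 2 * (1 + 2 / (p i * p j)) ^ 2 * (1 - successProb p Q φ n) := by
    filter_upwards [eventually_exp_le_profileProb hp_pos hQ hd i hτ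
        (fun m hm h => (hτpos m hm h).1) (hτi.trans_lt hDρ),
      eventually_exp_le_profileProb hp_pos hQ hd j hτ
        (fun m hm h => (hτpos m hm h).2) (hτj.trans_lt hDρ),
      eventually_exp_le_sparseSize hρ0.le hρ1, eventually_sum_sharedEdges_le hQ hd,
      eventually_half_le_typicalSet hp_pos hp_sum i, eventually_exists_label hp_pos i,
      eventually_exists_label hp_pos j, eventually_card_sparseSet]
      with n hni hnj hsize hshared htyp hi hj hcard
    have hs : (0 : ℝ) < sparseSize n := (Real.exp_pos _).trans_le hsize
    have hinv : 1 / ((sparseSet n).card : ℝ) ≤ Real.exp (-(ρ * Real.log n)) := by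
      rw [hcard, Real.exp_neg, one_div]
      exact inv_anti₀ (Real.exp_pos _) hsize
    refine sq_le_failure hd hp_pos hp_sum hQ hij (S := sparseSet n) (T := typicalSet p n)
      (x := fun m => ⌊τ m * Real.log n⌋₊) ?_ ?_ hi hj (fun v _ z => hshared v z) ?_
      (fun v _ => htyp v) φ
    · rw [← Finset.card_pos, hcard]
      exact_mod_cast hs
    · exact fun v hv z hz => relabel_mem_typicalLabelings (by simpa using hv) hz
    · rintro z hz l (rfl | rfl)
      · exact hinv.trans (hni z hz)
      · exact hinv.trans (hnj z hz)
  have hlim : Tendsto (fun n => 2 * (1 + 2 / (p i * p j)) ^ 2 * (1 - successProb p Q φ n)) atTop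
      (nhds 0) := by
    have h : Tendsto (successProb p Q φ) atTop (nhds 1) := hφ
    simpa using (h.const_sub 1).const_mul (2 * (1 + 2 / (p i * p j)) ^ 2)
  have h0 := ge_of_tendsto hlim hev
  have := hp_pos i
  have : 0 < (p i / 4) ^ 2 := by positivity
  linarith
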